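/- The \emph{paw} is the graph on four vertices consisting of a triangle together with a fourth vertex adjacent to exactly one vertex of the triangle; a graph is \emph{paw-free} if no induced subgraph of it is isomorphic to the paw. \textsc{Paw-free Edge Deletion} is the following parameterized problem: given a finite simple graph $G$ and an integer $k\ge 0$ (the parameter), is there a set $A\subseteq E(G)$ with $|A|\le k$ such that $G-A$ is paw-free? \textbf{Theorem.} \textsc{Paw-free Edge Deletion} has a kernel with $O(k^3)$ vertices. That is, there are a computable function $f:\mathbb N\to\mathbb N$ with $f(k)=O(k^3)$ as $k\to\infty$ and a polynomial-time algorithm that transforms every instance $(G,k)$ into an instance $(G',k')$ such that $(G,k)$ is a yes-instance if and only if $(G',k')$ is a yes-instance, and $|V(G')|+k'\le f(k)$. (Polynomial time means: the number of steps of a random access machine with addition and subtraction, but no multiplication, at unit cost per operation is bounded by a polynomial in the number of vertices of $G$ plus the number of binary digits of $k$.) -/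

import Mathlib

/-! ### Graphs: the paw and paw-free edge deletion -/

/-- The paw: the triangle `0, 1, 2` together with a vertex `3` adjacent exactly to `2`. -/
def paw : SimpleGraph (Fin 4) :=
  SimpleGraph.fromEdgeSet {s(0, 1), s(0, 2), s(1, 2), s(2, 3)}

/-- A graph is paw-free if it has no induced subgraph isomorphic to the paw. -/
def IsPawFree {V : Type*} (G : SimpleGraph V) : Prop :=
  ¬ paw.IsIndContained G

/-- `A` is a solution of paw-free edge deletion on `(G, k)`: a set of at most `k` edges of `G`
whose deletion leaves a paw-free graph. -/
def IsPawDeletionSolution {V : Type*} (G : SimpleGraph V) (k : ℕ) (A : Finset (Sym2 V)) : Prop :=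
  (A : Set (Sym2 V)) ⊆ G.edgeSet ∧ A.card ≤ k ∧ IsPawFree (G.deleteEdges (A : Set (Sym2 V)))

/-- An instance `(G, k)` of a parameterized graph problem: a finite graph `G` on the vertices
`0, …, n - 1` and a natural number `k`, the parameter. -/
structure GraphInstance where
  /-- number of vertices -/
  n : ℕ
  /-- the graph -/
  graph : SimpleGraph (Fin n)
  /-- the parameter -/
  k : ℕ

/-- Paw-free Edge Deletion, as the set of its yes-instances. -/
def PawFreeEdgeDeletion : Set GraphInstance :=
  {I | ∃ A : Finset (Sym2 (Fin I.n)), IsPawDeletionSolution I.graph I.k A}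

/-! ### The machine model: structured programs for a random access machine

The memory consists of registers and of two-dimensional arrays, all holding natural numbers and
addressed indirectly (array indices are computed values). The elementary operations are reading
and writing a cell, constants, addition and truncated subtraction, and every elementary operation
costs one step. There is no multiplication, so that numbers have polynomially many bits after
polynomially many steps, and polynomial time is the same as for Turing machines. -/

namespace RAM

/-- The memory: `reg x` is the register `x`, and `arr a i j` is the entry `(i, j)` of the
array `a`. -/
@[ext] structure State where
  /-- registers -/
  reg : ℕ → ℕ
  /-- arrays -/
  arr : ℕ → ℕ → ℕ → ℕ

/-- Writing a register. -/
def State.setReg (s : State) (x v : ℕ) : State where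
  reg := Function.update s.reg x v
  arr := s.arr

/-- Writing an array entry. -/
def State.setArr (s : State) (a i j v : ℕ) : State where
  reg := s.reg
  arr := fun a' i' j' => if a' = a ∧ i' = i ∧ j' = j then v else s.arr a' i' j'

/-- Expressions. -/
inductive Expr where
  /-- a constant -/
  | const (c : ℕ)
  /-- the contents of a register -/
  | reg (x : ℕ)
  /-- the entry of the array `a` at two computed indices -/
  | arr (a : ℕ) (i j : Expr)
  /-- addition -/
  | add (e₁ e₂ : Expr)
  /-- truncated subtraction -/
  | sub (e₁ e₂ : Expr)

/-- The value of an expression. -/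
def Expr.eval (s : State) : Expr → ℕ
  | .const c => c
  | .reg x => s.reg x
  | .arr a i j => s.arr a (i.eval s) (j.eval s)
  | .add e₁ e₂ => e₁.eval s + e₂.eval s
  | .sub e₁ e₂ => e₁.eval s - e₂.eval s

/-- The number of elementary operations in the evaluation of an expression. -/
def Expr.cost : Expr → ℕ
  | .const _ => 1
  | .reg _ => 1
  | .arr _ i j => i.cost + j.cost + 1
  | .add e₁ e₂ => e₁.cost + e₂.cost + 1
  | .sub e₁ e₂ => e₁.cost + e₂.cost + 1

/-- Programs. -/
inductive Prog where
  /-- do nothing -/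
  | skip
  /-- `reg x := e` -/
  | assign (x : ℕ) (e : Expr)
  /-- `arr a i j := e` -/
  | store (a : ℕ) (i j e : Expr)
  /-- first `p`, then `q` -/
  | seq (p q : Prog)
  /-- if `e ≠ 0` then `p` else `q` -/
  | ite (e : Expr) (p q : Prog)
  /-- while `e ≠ 0` do `p` -/
  | loop (e : Expr) (p : Prog)

/-- `Exec p s s' t`: the program `p`, started in the memory `s`, halts after exactly `t` steps
with the memory `s'`. -/
inductive Exec : Prog → State → State → ℕ → Prop where
  | skip (s : State) : Exec .skip s s 1
  | assign (x : ℕ) (e : Expr) (s : State) :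
      Exec (.assign x e) s (s.setReg x (e.eval s)) (e.cost + 1)
  | store (a : ℕ) (i j e : Expr) (s : State) :
      Exec (.store a i j e) s (s.setArr a (i.eval s) (j.eval s) (e.eval s))
        (i.cost + j.cost + e.cost + 1)
  | seq {p q : Prog} {s s' s'' : State} {t t' : ℕ} :
      Exec p s s' t → Exec q s' s'' t' → Exec (.seq p q) s s'' (t + t')
  | ite_true {e : Expr} {p q : Prog} {s s' : State} {t : ℕ} :
      e.eval s ≠ 0 → Exec p s s' t → Exec (.ite e p q) s s' (e.cost + 1 + t)
  | ite_false {e : Expr} {p q : Prog} {s s' : State} {t : ℕ} :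
      e.eval s = 0 → Exec q s s' t → Exec (.ite e p q) s s' (e.cost + 1 + t)
  | loop_done {e : Expr} {p : Prog} {s : State} :
      e.eval s = 0 → Exec (.loop e p) s s (e.cost + 1)
  | loop_step {e : Expr} {p : Prog} {s s' s'' : State} {t t' : ℕ} :
      e.eval s ≠ 0 → Exec p s s' t → Exec (.loop e p) s' s'' t' →
      Exec (.loop e p) s s'' (e.cost + 1 + t + t')

end RAM

/-! ### Kernelizations -/

namespace GraphInstance

/-- The length of the input, up to a polynomial: the number of vertices plus the number of
binary digits of the parameter. -/
def inputSize (I : GraphInstance) : ℕ := I.n + Nat.size I.k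

open Classical in
/-- The initial memory on input `(G, k)`: register `0` holds the number of vertices, register `1`
holds `k`, array `0` holds the adjacency matrix, and everything else is `0`. -/
noncomputable def initialState (I : GraphInstance) : RAM.State where
  reg := fun x => if x = 0 then I.n else if x = 1 then I.k else 0
  arr := fun a i j =>
    if a = 0 ∧ ∃ (hi : i < I.n) (hj : j < I.n), I.graph.Adj ⟨i, hi⟩ ⟨j, hj⟩ then 1 else 0

open Classical in
/-- The memory `s` presents `(G, k)` as an output: register `0` holds the number `n` of vertices,
register `1` holds `k`, and the upper left `n × n` block of array `0` is the adjacency matrix.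
The other cells may hold anything. -/
def IsOutput (I : GraphInstance) (s : RAM.State) : Prop :=
  s.reg 0 = I.n ∧ s.reg 1 = I.k ∧
    ∀ i j : Fin I.n, s.arr 0 i j = if I.graph.Adj i j then 1 else 0

end GraphInstance

/-- The parameterized graph problem `L` has a kernelization of size `f`, where the size of a graph
is its number of vertices: `f` is computable, and some program transforms, in time polynomial in
the length of the input, every instance `I = (G, k)` into an equivalent instance `I' = (G', k')`
with `|V(G')| + k' ≤ f(k)`. -/
def HasVertexKernel (L : Set GraphInstance) (f : ℕ → ℕ) : Prop :=
  Computable f ∧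
  ∃ (prog : RAM.Prog) (P : Polynomial ℕ), ∀ I : GraphInstance,
    ∃ (I' : GraphInstance) (s : RAM.State) (t : ℕ),
      RAM.Exec prog I.initialState s t ∧ t ≤ P.eval I.inputSize ∧ I'.IsOutput s ∧
      (I ∈ L ↔ I' ∈ L) ∧ I'.n + I'.k ≤ f I.k

/-! A component of a paw-free graph that contains a triangle is complete multipartite. The lemmas on
`FarFromPaws` prove this locally: if `x` lies in a triangle and no paw meets its closed
neighbourhood, then the ball of radius two around `x` is its whole component, and nonadjacency is
transitive there.

Five rules shrink `(G, k)`. Isolating `x` is safe if `x` is far from all paws; if `x` has `k + 1`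
further twins, since one of them is untouched by a given solution and can stand in for `x`; if `x`
lies in no triangle and could be replaced as the pendant vertex of any paw; or if twin classes are
small and `x` has very many co-twins, since then a triangle of untouched co-twins survives and
forces the component of `x` to be complete multipartite. Finally, an edge with many common
neighbours, each of which extends it to few copies of `K₄`, must be deleted.

Let no rule apply and let `A` be a solution. It touches at most `2k` vertices. An untouched vertex
in a triangle of `G - A` shares its component with a touched vertex, and the bounds on twin and
co-twin classes leave `O(k²)` of these. An untouched vertex whose triangles are all destroyed is a
common neighbour of the ends of an edge of `A`, and the forced edge rule leaves `O(k)` per edge.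
Every other nonisolated vertex is in no triangle and is attached to one of these `O(k²)` vertices,
at most `k + 1` to each, which gives `O(k³)` (`card_nonisolated_le`). A larger reduced graph is a
no-instance and is replaced by a paw with parameter `0`.

For the running time, the rules are first-order conditions with counting. They are written as
arithmetic terms with sums over the vertices, and `runs_compile` turns every such term into a
polynomial-time program. Each effective round removes an edge, so `n * n` rounds suffice. -/

/-! ### Paws in elementary terms -/

section PawStructure

variable {V : Type*}

/-- Every triangle `p, q, s` and every neighbour `r` of `s` span more than a paw. -/
def NoPaw (G : SimpleGraph V) : Prop :=
  ∀ p q s r, G.Adj p q → G.Adj p s → G.Adj q s → G.Adj r s → G.Adj r p ∨ G.Adj r q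

/-- No paw meets the closed neighbourhood of `x`. -/
def FarFromPaws (G : SimpleGraph V) (x : V) : Prop :=
  ∀ p q s r, G.Adj p q → G.Adj p s → G.Adj q s → G.Adj r s →
    (∃ y, (y = x ∨ G.Adj x y) ∧ (y = p ∨ y = q ∨ y = s ∨ y = r)) → G.Adj r p ∨ G.Adj r q

/-- The vertex `x` lies in a triangle. -/
def InTriangle (G : SimpleGraph V) (x : V) : Prop :=
  ∃ y z, G.Adj x y ∧ G.Adj x z ∧ G.Adj y z

/-- The vertices at distance at most two from `x`. -/
def ballTwo (G : SimpleGraph V) (x : V) : Set V :=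
  {y | y = x ∨ G.Adj x y ∨ ∃ c, G.Adj x c ∧ G.Adj c y}

theorem paw_adj (i j : Fin 4) : paw.Adj i j ↔
    (i, j) ∈ [((0 : Fin 4), (1 : Fin 4)), (1, 0), (0, 2), (2, 0), (1, 2), (2, 1),
      (2, 3), (3, 2)] := by
  fin_cases i <;> fin_cases j <;> simp [paw]

/-- Distinctness need not be required in `NoPaw`: for `r = p` the edge `pq` already gives the
conclusion, and likewise for `r = q`. -/
theorem isPawFree_iff_noPaw (G : SimpleGraph V) : IsPawFree G ↔ NoPaw G := by
  constructor
  · intro h p q s r hpq hps hqs hrs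
    by_contra hcon
    push Not at hcon
    obtain ⟨hrp, hrq⟩ := hcon
    apply h
    have hpr : ¬ G.Adj p r := fun h => hrp h.symm
    have hqr : ¬ G.Adj q r := fun h => hrq h.symm
    have hne : p ≠ r := by rintro rfl; exact hrq hpq
    have hne' : q ≠ r := by rintro rfl; exact hrp hpq.symm
    refine ⟨⟨⟨![p, q, s, r], ?_⟩, ?_⟩⟩
    · intro i j hij
      fin_cases i <;> fin_cases j <;>
        simp [hpq.ne, hpq.ne', hps.ne, hps.ne', hqs.ne, hqs.ne', hrs.ne, hrs.ne', hne, hne',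
          hne.symm, hne'.symm] at hij ⊢
    · intro i j
      change G.Adj (![p, q, s, r] i) (![p, q, s, r] j) ↔ _
      rw [paw_adj]
      fin_cases i <;> fin_cases j <;>
        simp [hpq, hpq.symm, hps, hps.symm, hqs, hqs.symm, hrs, hrs.symm, hrp, hrq, hpr, hqr]
  · rintro h ⟨f⟩
    have key : ∀ i j, G.Adj (f i) (f j) ↔ paw.Adj i j := fun i j => f.map_adj_iff
    have := h (f 0) (f 1) (f 2) (f 3)
    rw [key, key, key, key, key, key] at this
    simp [paw_adj] at this

theorem NoPaw.farFromPaws {G : SimpleGraph V} (h : NoPaw G) (x : V) : FarFromPaws G x :=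
  fun p q s r h1 h2 h3 h4 _ => h p q s r h1 h2 h3 h4

theorem mem_ballTwo_comm {G : SimpleGraph V} {x y : V} (h : y ∈ ballTwo G x) :
    x ∈ ballTwo G y := by
  rcases h with h | h | ⟨c, h, h'⟩
  · exact .inl h.symm
  · exact .inr (.inl h.symm)
  · exact .inr (.inr ⟨c, h'.symm, h.symm⟩)

theorem self_mem_ballTwo (G : SimpleGraph V) (x : V) : x ∈ ballTwo G x := .inl rfl

/-! ### The component of a triangle vertex far from paws is complete multipartite -/

section

variable {G : SimpleGraph V} {x : V} (hx : FarFromPaws G x) (ht : InTriangle G x)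
include hx ht

theorem FarFromPaws.exists_common {c : V} (hc : G.Adj x c) : ∃ e, G.Adj x e ∧ G.Adj c e := by
  obtain ⟨e, f, he, hf, hef⟩ := ht
  rcases hx e f x c hef he.symm hf.symm hc.symm ⟨x, .inl rfl, by simp⟩ with h | h
  · exact ⟨e, he, h⟩
  · exact ⟨f, hf, h⟩

/-- In a complete multipartite graph every edge dominates. If `y` is reached through `d` and `d`
misses `c`, a triangle `x, c, e` transfers the adjacency: `d` must see `e`, so `y` sees `x` or `e`,
and in the latter case `y` hangs at the triangle `x, c, e`. -/
theorem FarFromPaws.dominating {c y : V} (hc : G.Adj x c) (hy : y ∈ ballTwo G x) :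
    G.Adj y x ∨ G.Adj y c := by
  rcases hy with rfl | hy | ⟨d, hd, hy⟩
  · exact .inr hc
  · exact .inl hy.symm
  · by_cases hdc : G.Adj d c
    · exact hx x c d y hc hd hdc.symm hy.symm ⟨x, by simp⟩
    · obtain ⟨e, he, hce⟩ := hx.exists_common ht hc
      have hde : G.Adj d e :=
        (hx c e x d hce hc.symm he.symm hd.symm ⟨x, by simp⟩).resolve_left hdc
      rcases hx x e d y he hd hde.symm hy.symm ⟨x, by simp⟩ with h | h
      · exact .inl h
      · exact hx x c e y hc he hce h ⟨x, by simp⟩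

/-- If `y` is not adjacent to `x`, it is adjacent to both other vertices of a triangle at `x`. The
three form a triangle meeting the neighbourhood of `x`, so any neighbour of `y` sees one of these
two neighbours of `x`. -/
theorem FarFromPaws.ball_closed {y z : V} (hy : y ∈ ballTwo G x) (hyz : G.Adj y z) :
    z ∈ ballTwo G x := by
  by_cases hxy : G.Adj y x
  · exact .inr (.inr ⟨y, hxy.symm, hyz⟩)
  · obtain ⟨c, e, hc, he, hce⟩ := id ht
    have hyc := (hx.dominating ht hc hy).resolve_left hxy
    have hye := (hx.dominating ht he hy).resolve_left hxy
    rcases hx c e y z hce hyc.symm hye.symm hyz.symm ⟨c, .inr hc, by simp⟩ with h | h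
    · exact .inr (.inr ⟨c, hc, h.symm⟩)
    · exact .inr (.inr ⟨e, he, h.symm⟩)

theorem FarFromPaws.ball_multipartite {p q r : V} (hp : p ∈ ballTwo G x) (hq : q ∈ ballTwo G x)
    (hr : r ∈ ballTwo G x) (hpq : G.Adj p q) : G.Adj r p ∨ G.Adj r q := by
  by_cases hpx : G.Adj x p <;> by_cases hqx : G.Adj x q <;> by_cases hrx : G.Adj x r
  · exact hx p q x r hpq hpx.symm hqx.symm hrx.symm ⟨x, by simp⟩
  · exact .inl ((hx.dominating ht hpx hr).resolve_left fun h => hrx h.symm)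
  · exact .inr ((hx.dominating ht hrx hq).resolve_left fun h => hqx h.symm).symm
  · exact .inl ((hx.dominating ht hpx hr).resolve_left fun h => hrx h.symm)
  · exact .inl ((hx.dominating ht hrx hp).resolve_left fun h => hpx h.symm).symm
  · exact .inr ((hx.dominating ht hqx hr).resolve_left fun h => hrx h.symm)
  -- If neither `p` nor `q` is adjacent to `x`, both are adjacent to a neighbour `c` of `x`, and `x`
  -- is pendant at the triangle `p, q, c`: a forbidden paw.
  all_goals
    obtain ⟨c, e, hc, he, hce⟩ := id ht
    have hpc := (hx.dominating ht hc hp).resolve_left fun h => hpx h.symm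
    have hqc := (hx.dominating ht hc hq).resolve_left fun h => hqx h.symm
    rcases hx p q c x hpq hpc hqc hc ⟨x, by simp⟩ with h | h
    exacts [absurd h hpx, absurd h hqx]

/-- Two nonadjacent vertices of the same complete multipartite component have the same
neighbours. -/
theorem FarFromPaws.adj_iff_of_not_adj {y z : V} (hy : y ∈ ballTwo G x) (hz : z ∈ ballTwo G x)
    (hyz : ¬ G.Adj y z) (a : V) : G.Adj y a ↔ G.Adj z a := by
  constructor
  · intro h
    exact (hx.ball_multipartite ht hy (hx.ball_closed ht hy h) hz h).resolve_left
      fun h => hyz h.symm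
  · intro h
    exact (hx.ball_multipartite ht hz (hx.ball_closed ht hz h) hy h).resolve_left hyz

theorem FarFromPaws.inTriangle_of_mem {y : V} (hy : y ∈ ballTwo G x) : InTriangle G y := by
  by_cases hxy : G.Adj x y
  · obtain ⟨e, he, hye⟩ := hx.exists_common ht hxy
    exact ⟨x, e, hxy.symm, hye, he⟩
  · obtain ⟨c, e, hc, he, hce⟩ := id ht
    exact ⟨c, e, (hx.dominating ht hc hy).resolve_left fun h => hxy h.symm,
      (hx.dominating ht he hy).resolve_left fun h => hxy h.symm, hce⟩

theorem FarFromPaws.mem_ballTwo_of_mem {y z : V} (hy : y ∈ ballTwo G x) (hz : z ∈ ballTwo G x) :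
    z ∈ ballTwo G y := by
  by_cases hyz : G.Adj y z
  · exact .inr (.inl hyz)
  · obtain ⟨c, -, hc, -, -⟩ := hx.inTriangle_of_mem ht hy
    exact .inr (.inr ⟨c, hc, ((hx.adj_iff_of_not_adj ht hy hz hyz c).1 hc).symm⟩)

end

end PawStructure

/-! ### Reduction rules -/

section Rules

open Classical

variable {V : Type*}

/-- The graph in which all edges at `x` are deleted. -/
def isolate (G : SimpleGraph V) (x : V) : SimpleGraph V where
  Adj a b := G.Adj a b ∧ a ≠ x ∧ b ≠ x
  symm := ⟨fun _ _ h => ⟨h.1.symm, h.2.2, h.2.1⟩⟩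
  loopless := ⟨fun _ h => h.1.ne rfl⟩

@[simp] theorem isolate_adj {G : SimpleGraph V} {x a b : V} :
    (isolate G x).Adj a b ↔ G.Adj a b ∧ a ≠ x ∧ b ≠ x := Iff.rfl

/-- At most `k` edges can be deleted to destroy all paws. -/
def PawDeletable (G : SimpleGraph V) (k : ℕ) : Prop :=
  ∃ A : Finset (Sym2 V), A.card ≤ k ∧ NoPaw (G.deleteEdges (A : Set (Sym2 V)))

/-- Deleting non-edges has no effect. Dropping `A ⊆ E(G)` lets the same set `A` serve for `G` and
its subgraphs. -/
theorem exists_solution_iff (G : SimpleGraph V) (k : ℕ) :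
    (∃ A : Finset (Sym2 V), IsPawDeletionSolution G k A) ↔ PawDeletable G k := by
  constructor
  · rintro ⟨A, -, h, h'⟩
    exact ⟨A, h, (isPawFree_iff_noPaw _).1 h'⟩
  · rintro ⟨A, h, h'⟩
    refine ⟨A.filter (· ∈ G.edgeSet), fun e he => (Finset.mem_filter.1 he).2,
      (Finset.card_filter_le _ _).trans h, (isPawFree_iff_noPaw _).2 ?_⟩
    convert h' using 1
    ext a b
    simp only [SimpleGraph.deleteEdges_adj, Finset.mem_coe, Finset.mem_filter,
      SimpleGraph.mem_edgeSet]
    tauto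

theorem PawDeletable.exists_subset {G : SimpleGraph V} {k : ℕ} (h : PawDeletable G k) :
    ∃ A : Finset (Sym2 V), (A : Set (Sym2 V)) ⊆ G.edgeSet ∧ A.card ≤ k ∧
      NoPaw (G.deleteEdges (A : Set (Sym2 V))) := by
  obtain ⟨A, h1, h2, h3⟩ := (exists_solution_iff G k).2 h
  exact ⟨A, h1, h2, (isPawFree_iff_noPaw _).1 h3⟩

/-- The paw has no isolated vertex, so isolating a vertex creates no induced paw. -/
theorem PawDeletable.isolate {G : SimpleGraph V} {k : ℕ} (h : PawDeletable G k) (x : V) :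
    PawDeletable (isolate G x) k := by
  obtain ⟨A, h, h'⟩ := h
  refine ⟨A, h, fun p q s r hpq hps hqs hrs => ?_⟩
  simp only [SimpleGraph.deleteEdges_adj, isolate_adj] at *
  have := h' p q s r
  simp only [SimpleGraph.deleteEdges_adj] at this
  tauto

/-- Same neighbourhoods. -/
def Twin (G : SimpleGraph V) (x y : V) : Prop := ∀ z, G.Adj x z ↔ G.Adj y z

theorem Twin.symm {G : SimpleGraph V} {x y : V} (h : Twin G x y) : Twin G y x :=
  fun z => (h z).symm

theorem Twin.trans {G : SimpleGraph V} {x y z : V} (h : Twin G x y) (h' : Twin G y z) :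
    Twin G x z := fun w => (h w).trans (h' w)

theorem Twin.not_adj {G : SimpleGraph V} {x y : V} (h : Twin G x y) : ¬ G.Adj x y :=
  fun h' => G.loopless.irrefl y ((h y).1 h')

/-- Same neighbourhoods up to twins. -/
def CoTwin (G : SimpleGraph V) (x y : V) : Prop :=
  ∀ z, (G.Adj x z ∨ Twin G x z) ↔ (G.Adj y z ∨ Twin G y z)

theorem CoTwin.adj_of_not_twin {G : SimpleGraph V} {x y : V} (h : CoTwin G x y)
    (h' : ¬ Twin G x y) : G.Adj x y :=
  ((h y).2 (.inr fun _ => Iff.rfl)).resolve_right h'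

theorem CoTwin.trans {G : SimpleGraph V} {x y z : V} (h : CoTwin G x y) (h' : CoTwin G y z) :
    CoTwin G x z := fun w => (h w).trans (h' w)

theorem CoTwin.symm {G : SimpleGraph V} {x y : V} (h : CoTwin G x y) : CoTwin G y x :=
  fun z => (h z).symm

variable [Fintype V]

/-- The class of twins of `x` has more than `k + 1` members. -/
def ManyTwins (G : SimpleGraph V) (k : ℕ) (x : V) : Prop :=
  (∃ y, G.Adj x y) ∧ k + 2 ≤ (Finset.univ.filter fun y => Twin G x y).card

/-- The vertex `x` is in no triangle, and it is superfluous as the end of a pendant edge. -/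
def SuperfluousPendant (G : SimpleGraph V) (k : ℕ) (x : V) : Prop :=
  ¬ InTriangle G x ∧ ∀ z, G.Adj x z → InTriangle G z →
    k + 2 ≤ (Finset.univ.filter fun w => G.Adj z w ∧ ¬ InTriangle G w).card

/-- The vertices that a reduction rule allows to isolate. -/
def Isolatable (G : SimpleGraph V) (k : ℕ) (x : V) : Prop :=
  (∃ y, G.Adj x y) ∧ (FarFromPaws G x ∨ ManyTwins G k x ∨
    ((∀ y, ¬ ManyTwins G k y) ∧ 5 * k + 4 ≤ (Finset.univ.filter fun y => CoTwin G x y).card) ∨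
    SuperfluousPendant G k x)

/-- A condition under which every solution has to delete the edge `uv`. -/
def ForcedEdge (G : SimpleGraph V) (k : ℕ) (u v : V) : Prop :=
  G.Adj u v ∧ 1 ≤ k ∧ (∀ y, ¬ ManyTwins G k y) ∧
    5 * k + 2 ≤ (Finset.univ.filter fun w => G.Adj u w ∧ G.Adj v w ∧
      (Finset.univ.filter fun z => G.Adj w z ∧ G.Adj u z ∧ G.Adj v z).card ≤ 2 * k).card

/-- The endpoints of the edges in `A`. -/
noncomputable def touched (A : Finset (Sym2 V)) : Finset V :=
  Finset.univ.filter fun x => ∃ e ∈ A, x ∈ e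

theorem card_touched_le (A : Finset (Sym2 V)) : (touched A).card ≤ 2 * A.card := by
  have h : touched A ⊆ A.biUnion fun e => e.toFinset := by
    intro x hx
    simpa [touched] using hx
  refine (Finset.card_le_card h).trans ?_
  rw [mul_comm]
  refine Finset.card_biUnion_le_card_mul _ _ _ fun e _ => ?_
  by_cases he : e.IsDiag
  · rw [Sym2.card_toFinset_of_isDiag e he]; norm_num
  · rw [Sym2.card_toFinset_of_not_isDiag e he]

theorem adj_deleteEdges_of_not_touched {G : SimpleGraph V} {A : Finset (Sym2 V)} {x : V}
    (hx : x ∉ touched A) (y : V) :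
    (G.deleteEdges (A : Set (Sym2 V))).Adj x y ↔ G.Adj x y := by
  simp only [SimpleGraph.deleteEdges_adj, Finset.mem_coe, and_iff_left_iff_imp]
  intro _ h
  exact hx (by simpa [touched] using ⟨_, h, Sym2.mem_mk_left x y⟩)

/-! ### Safety of the four isolation rules -/

/-- If `x` is in a triangle, its component in `G` is complete multipartite, hence paw-free, and the
solution may drop all edges there. If not, `x` could only be the pendant vertex of a paw of `G - A`;
its triangle together with `x` is no paw in `G`, which would put `x` in a triangle. -/
theorem PawDeletable.of_isolate_far {G : SimpleGraph V} {k : ℕ} {x : V}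
    (h : PawDeletable (_root_.isolate G x) k) (hx : FarFromPaws G x) : PawDeletable G k := by
  obtain ⟨A, hA, hno⟩ := h
  by_cases ht : InTriangle G x
  · refine ⟨A.filter fun e => ∀ y ∈ e, y ∉ ballTwo G x, (Finset.card_filter_le _ _).trans hA, ?_⟩
    intro p q s r hpq hps hqs hrs
    by_cases hs : s ∈ ballTwo G x
    · have hp := hx.ball_closed ht hs hps.1.symm
      have hq := hx.ball_closed ht hs hqs.1.symm
      have hr := hx.ball_closed ht hs hrs.1.symm
      have := hx.ball_multipartite ht hp hq hr hpq.1
      simp only [SimpleGraph.deleteEdges_adj, Finset.mem_coe, Finset.mem_filter, Sym2.mem_iff]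
      simpa [hp, hq, hr] using this
    · have hp : p ∉ ballTwo G x := fun h => hs (hx.ball_closed ht h hps.1)
      have hq : q ∉ ballTwo G x := fun h => hs (hx.ball_closed ht h hqs.1)
      have hr : r ∉ ballTwo G x := fun h => hs (hx.ball_closed ht h hrs.1)
      have key : ∀ a b, a ∉ ballTwo G x → b ∉ ballTwo G x →
          ((G.deleteEdges ((A.filter fun e => ∀ y ∈ e, y ∉ ballTwo G x :
            Finset (Sym2 V)) : Set (Sym2 V))).Adj a b ↔
          ((_root_.isolate G x).deleteEdges (A : Set (Sym2 V))).Adj a b) := by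
        intro a b ha hb
        have ha' : a ≠ x := by rintro rfl; exact ha (self_mem_ballTwo _ _)
        have hb' : b ≠ x := by rintro rfl; exact hb (self_mem_ballTwo _ _)
        simp [ha, hb, ha', hb']
      rw [key _ _ hr hp, key _ _ hr hq]
      exact hno p q s r ((key _ _ hp hq).1 hpq) ((key _ _ hp hs).1 hps) ((key _ _ hq hs).1 hqs)
        ((key _ _ hr hs).1 hrs)
  · refine ⟨A, hA, fun p q s r hpq hps hqs hrs => ?_⟩
    have hp : p ≠ x := by rintro rfl; exact ht ⟨q, s, hpq.1, hps.1, hqs.1⟩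
    have hq : q ≠ x := by rintro rfl; exact ht ⟨p, s, hpq.1.symm, hqs.1, hps.1⟩
    have hs : s ≠ x := by rintro rfl; exact ht ⟨p, q, hps.1.symm, hqs.1.symm, hpq.1⟩
    have hr : r ≠ x := by
      rintro rfl
      rcases hx p q s r hpq.1 hps.1 hqs.1 hrs.1 ⟨r, by simp⟩ with h | h
      · exact ht ⟨p, s, h, hrs.1, hps.1⟩
      · exact ht ⟨q, s, h, hrs.1, hqs.1⟩
    have := hno p q s r
    simp only [SimpleGraph.deleteEdges_adj, isolate_adj] at *
    tauto

/-- Twins are nonadjacent, so each edge of `A` touches at most one of the `k + 1` other twins of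
`x`, and some twin `y` stays untouched. Replacing `x` by `y` moves any paw of `G - A` away from `x`.
-/
theorem PawDeletable.of_isolate_twins {G : SimpleGraph V} {k : ℕ} {x : V}
    (h : PawDeletable (_root_.isolate G x) k) (hx : ManyTwins G k x) : PawDeletable G k := by
  obtain ⟨A, hsub, hA, hno⟩ := h.exists_subset
  have hxA : x ∉ touched A := by
    simp only [touched, Finset.mem_filter, Finset.mem_univ, true_and, not_exists, not_and]
    rintro e he hxe
    have := hsub he
    induction e with | _ a b =>
    simp only [SimpleGraph.mem_edgeSet, isolate_adj] at this
    rcases Sym2.mem_iff.1 hxe with rfl | rfl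
    exacts [this.2.1 rfl, this.2.2 rfl]
  obtain ⟨y, hy, hyx, hyA⟩ : ∃ y, Twin G x y ∧ y ≠ x ∧ y ∉ touched A := by
    by_contra! hcon
    have hle : ((Finset.univ.filter fun y => Twin G x y).erase x).card ≤ A.card := by
      have : ∀ y, y ∈ (Finset.univ.filter fun y => Twin G x y).erase x → ∃ e, e ∈ A ∧ y ∈ e := by
        intro y hy
        simp only [Finset.mem_erase, Finset.mem_filter, Finset.mem_univ, true_and] at hy
        simpa [touched] using hcon y hy.2 hy.1
      have hne : Nonempty (Sym2 V) := ⟨s(x, x)⟩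
      choose! g hg hg' using this
      refine Finset.card_le_card_of_injOn g (fun y hy => hg y hy) fun y hy z hz hyz => ?_
      by_contra hne
      have he : g y = s(y, z) :=
        (Sym2.mem_and_mem_iff hne).1 ⟨hg' y hy, hyz ▸ hg' z hz⟩
      have := hsub (hg y hy)
      rw [he] at this
      have hy' := (Finset.mem_filter.1 (Finset.mem_of_mem_erase hy)).2
      have hz' := (Finset.mem_filter.1 (Finset.mem_of_mem_erase hz)).2
      exact (hy'.symm.trans hz').not_adj this.1
    have := Finset.pred_card_le_card_erase (s := Finset.univ.filter fun y => Twin G x y) (a := x)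
    have := hx.2
    omega
  refine ⟨A, hA, ?_⟩
  set H := G.deleteEdges (A : Set (Sym2 V)) with hH
  have hHxy : ∀ z, H.Adj x z ↔ H.Adj y z := fun z => by
    rw [hH, adj_deleteEdges_of_not_touched hxA, adj_deleteEdges_of_not_touched hyA, hy z]
  let φ : V → V := fun a => if a = x then y else a
  have hφx : ∀ a, φ a ≠ x := by
    intro a
    by_cases ha : a = x <;> simp [φ, ha, hyx]
  have h1 : ∀ a b, H.Adj (φ a) b ↔ H.Adj a b := by
    intro a b
    by_cases ha : a = x
    · simp [φ, ha, hHxy]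
    · simp [φ, ha]
  have h2 : ∀ a b, H.Adj (φ a) (φ b) ↔ H.Adj a b := by
    intro a b
    rw [h1, H.adj_comm, h1, H.adj_comm]
  have h3 : ∀ a b, ((_root_.isolate G x).deleteEdges (A : Set (Sym2 V))).Adj (φ a) (φ b) ↔
      H.Adj a b := by
    intro a b
    rw [← h2, hH]
    simp [hφx]
  intro p q s r
  have := hno (φ p) (φ q) (φ s) (φ r)
  simpa only [h3] using this

/-- The vertex `x` can only be pendant in a paw. The triangle vertex it hangs at has `k + 1` other
neighbours in no triangle; one of these edges survives, and its end replaces `x`. -/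
theorem PawDeletable.of_isolate_pendant {G : SimpleGraph V} {k : ℕ} {x : V}
    (h : PawDeletable (_root_.isolate G x) k) (hx : SuperfluousPendant G k x) :
    PawDeletable G k := by
  obtain ⟨A, hA, hno⟩ := h
  obtain ⟨ht, hx⟩ := hx
  refine ⟨A, hA, fun p q s r hpq hps hqs hrs => ?_⟩
  have hp : p ≠ x := by rintro rfl; exact ht ⟨q, s, hpq.1, hps.1, hqs.1⟩
  have hq : q ≠ x := by rintro rfl; exact ht ⟨p, s, hpq.1.symm, hqs.1, hps.1⟩
  have hs : s ≠ x := by rintro rfl; exact ht ⟨p, q, hps.1.symm, hqs.1.symm, hpq.1⟩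
  have hno' := fun w => hno p q s w
  simp only [SimpleGraph.deleteEdges_adj, isolate_adj] at hno' hpq hps hqs
  by_cases hr : r = x
  · subst hr
    have hcard := hx s hrs.1 ⟨p, q, hps.1.symm, hqs.1.symm, hpq.1⟩
    obtain ⟨w, hw, hwt, hwr, hwA⟩ :
        ∃ w, G.Adj s w ∧ ¬ InTriangle G w ∧ w ≠ r ∧ s(w, s) ∉ A := by
      by_contra! hcon
      have hle : ((Finset.univ.filter fun w => G.Adj s w ∧ ¬ InTriangle G w).erase r).card
          ≤ A.card := by
        refine Finset.card_le_card_of_injOn (fun w => s(w, s)) (fun w hw => ?_)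
          fun y _ z _ hyz => Sym2.congr_left.1 hyz
        have hw := Finset.mem_erase.1 (Finset.mem_coe.1 hw)
        have hw' := (Finset.mem_filter.1 hw.2).2
        exact hcon w hw'.1 hw'.2 hw.1
      have := Finset.pred_card_le_card_erase
        (s := Finset.univ.filter fun w => G.Adj s w ∧ ¬ InTriangle G w) (a := r)
      omega
    have h1 : ¬ G.Adj w p := fun h => hwt ⟨p, s, h, hw.symm, hps.1⟩
    have h2 : ¬ G.Adj w q := fun h => hwt ⟨q, s, h, hw.symm, hqs.1⟩
    have h3 := hw.symm
    have := hno' w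
    simp only [Finset.mem_coe] at *
    tauto
  · have := hno' r
    simp only [SimpleGraph.deleteEdges_adj] at hrs ⊢
    tauto

theorem card_twins_le {G : SimpleGraph V} {k : ℕ} (hno : ∀ y, ¬ ManyTwins G k y) {x : V}
    (hx : ∃ y, G.Adj x y) : (Finset.univ.filter fun y => Twin G x y).card ≤ k + 1 := by
  by_contra! h
  exact hno x ⟨hx, h⟩

theorem mem_touched {A : Finset (Sym2 V)} {x : V} : x ∈ touched A ↔ ∃ e ∈ A, x ∈ e := by
  simp [touched]

/-- Co-twins are twins or adjacent. Three untouched co-twins from different twin classes form a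
triangle that no solution destroys, so without the twin class of `x` their component is complete
multipartite, and it is exactly the neighbourhood of `x`. If all edges at the twin class of `x` are
kept, that class is one more part. -/
theorem PawDeletable.of_isolate_coTwins {G : SimpleGraph V} {k : ℕ} {x : V}
    (h : PawDeletable (_root_.isolate G x) k) (hx : ∃ y, G.Adj x y)
    (hno : ∀ y, ¬ ManyTwins G k y)
    (hcard : 5 * k + 4 ≤ (Finset.univ.filter fun y => CoTwin G x y).card) : PawDeletable G k := by
  obtain ⟨A, hA, hfree⟩ := h
  have hM := card_touched_le A
  -- three pairwise adjacent untouched vertices outside the twin class of `x`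
  set K := Finset.univ.filter fun y => CoTwin G x y with hK
  set K₁ := (K \ Finset.univ.filter fun y => Twin G x y) \ touched A with hK₁
  -- From `5k + 4`, remove at most `k + 1` twins of `x` and `2k` touched vertices. What remains
  -- exceeds two twin classes of size `k + 1`.
  have hK₁card : 2 * k + 3 ≤ K₁.card := by
    have h1 := Finset.le_card_sdiff (Finset.univ.filter fun y => Twin G x y) K
    have h2 := Finset.le_card_sdiff (touched A) (K \ Finset.univ.filter fun y => Twin G x y)
    have h3 := card_twins_le hno hx
    rw [hK₁]
    omega
  have hKmem : ∀ {y}, y ∈ K₁ ↔ (CoTwin G x y ∧ ¬ Twin G x y) ∧ y ∉ touched A := by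
    intro y; simp [hK₁, hK]
  have hadj : ∀ {y z}, y ∈ K₁ → z ∈ K₁ → ¬ Twin G y z → G.Adj y z := fun hy hz hyz =>
    ((hKmem.1 hy).1.1.symm.trans (hKmem.1 hz).1.1).adj_of_not_twin hyz
  have hnbr : ∀ {y}, y ∈ K₁ → ∃ z, G.Adj y z := fun hy =>
    ⟨x, ((hKmem.1 hy).1.1.adj_of_not_twin (hKmem.1 hy).1.2).symm⟩
  obtain ⟨y, hy⟩ : K₁.Nonempty := Finset.card_pos.1 (by omega)
  obtain ⟨z, hz⟩ : (K₁ \ Finset.univ.filter fun z => Twin G y z).Nonempty := by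
    have h1 := Finset.le_card_sdiff (Finset.univ.filter fun z => Twin G y z) K₁
    have h3 := card_twins_le hno (hnbr hy)
    exact Finset.card_pos.1 (by omega)
  simp only [Finset.mem_sdiff, Finset.mem_filter, Finset.mem_univ, true_and] at hz
  obtain ⟨hz, hyz⟩ := hz
  obtain ⟨t, ht⟩ : ((K₁ \ Finset.univ.filter fun t => Twin G y t) \
      Finset.univ.filter fun t => Twin G z t).Nonempty := by
    have h1 := Finset.le_card_sdiff (Finset.univ.filter fun t => Twin G y t) K₁
    have h2 := Finset.le_card_sdiff (Finset.univ.filter fun t => Twin G z t)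
      (K₁ \ Finset.univ.filter fun t => Twin G y t)
    have h3 := card_twins_le hno (hnbr hy)
    have h4 := card_twins_le hno (hnbr hz)
    exact Finset.card_pos.1 (by omega)
  simp only [Finset.mem_sdiff, Finset.mem_filter, Finset.mem_univ, true_and] at ht
  obtain ⟨⟨ht, hyt⟩, hzt⟩ := ht
  replace hyz := hadj hy hz hyz
  replace hyt := hadj hy ht hyt
  replace hzt := hadj hz ht hzt
  obtain ⟨⟨hcy, hxy⟩, hyA⟩ := hKmem.1 hy
  obtain ⟨⟨hcz, hxz⟩, hzA⟩ := hKmem.1 hz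
  obtain ⟨⟨hct, hxt⟩, -⟩ := hKmem.1 ht
  -- keep all edges at the twin class of `x`
  set A₀ := A.filter fun e => ∀ a ∈ e, ¬ Twin G x a with hA₀
  refine ⟨A₀, (Finset.card_filter_le _ _).trans hA, ?_⟩
  set H₀ := G.deleteEdges (A₀ : Set (Sym2 V)) with hH₀
  have hP : ∀ {a} b, Twin G x a → (H₀.Adj a b ↔ G.Adj x b) := by
    intro a b ha
    rw [ha b]
    simp only [hH₀, hA₀, SimpleGraph.deleteEdges_adj, Finset.mem_coe, Finset.mem_filter,
      Sym2.mem_iff]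
    constructor
    · exact fun h => h.1
    · exact fun h => ⟨h, fun h' => h'.2 a (.inl rfl) ha⟩
  -- the graph without the twin class of `x`
  let H₁ : SimpleGraph V :=
    { Adj := fun a b => H₀.Adj a b ∧ ¬ Twin G x a ∧ ¬ Twin G x b
      symm := ⟨fun _ _ h => ⟨h.1.symm, h.2.2, h.2.1⟩⟩
      loopless := ⟨fun _ h => h.1.ne rfl⟩ }
  have hxx : Twin G x x := fun _ => Iff.rfl
  have hH₁ : ∀ {a b}, ¬ Twin G x a → ¬ Twin G x b →
      (H₁.Adj a b ↔ ((_root_.isolate G x).deleteEdges (A : Set (Sym2 V))).Adj a b) := by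
    intro a b ha hb
    have ha' : a ≠ x := by rintro rfl; exact ha hxx
    have hb' : b ≠ x := by rintro rfl; exact hb hxx
    simp [H₁, hH₀, hA₀, ha, hb, ha', hb']
  have hnoH₁ : NoPaw H₁ := by
    intro p q s r hpq hps hqs hrs
    rw [hH₁ hrs.2.1 hps.2.1, hH₁ hrs.2.1 hpq.2.2]
    exact hfree p q s r ((hH₁ hpq.2.1 hpq.2.2).1 hpq) ((hH₁ hps.2.1 hps.2.2).1 hps)
      ((hH₁ hqs.2.1 hqs.2.2).1 hqs) ((hH₁ hrs.2.1 hrs.2.2).1 hrs)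
  have hunt : ∀ {w}, w ∉ touched A → ¬ Twin G x w → ∀ b, ¬ Twin G x b →
      (H₁.Adj w b ↔ G.Adj w b) := by
    intro w hw hxw b hb
    have : s(w, b) ∉ A := fun h => hw (mem_touched.2 ⟨_, h, Sym2.mem_mk_left _ _⟩)
    simp [H₁, hH₀, hA₀, hxw, hb, this]
  have htri : InTriangle H₁ y := by
    refine ⟨z, t, (hunt hyA hxy z hxz).2 hyz, (hunt hyA hxy t hxt).2 hyt,
      (hunt hzA hxz t hxt).2 hzt⟩
  have hfar := hnoH₁.farFromPaws y
  -- The edge `yz` dominates the component of `y`. As `y` and `z` are untouched co-twins of `x`,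
  -- adjacency to one of them in `H₁` means adjacency to `x` in `G`, outside the twin class of `x`.
  have hD : ∀ {a}, ¬ Twin G x a → (a ∈ ballTwo H₁ y ↔ G.Adj x a) := by
    intro a ha
    have hax : (G.Adj x a ∨ Twin G x a) ↔ G.Adj x a := by simp [ha]
    rw [← hax]
    constructor
    · intro h
      rcases hfar.dominating htri ((hunt hyA hxy z hxz).2 hyz) h with h | h
      · exact (hcy a).2 (.inl ((hunt hyA hxy a ha).1 h.symm))
      · exact (hcz a).2 (.inl ((hunt hzA hxz a ha).1 h.symm))
    · intro h
      rcases (hcy a).1 h with h | h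
      · exact .inr (.inl ((hunt hyA hxy a ha).2 h))
      · exact .inr (.inr ⟨z, (hunt hyA hxy z hxz).2 hyz,
          ((hunt hzA hxz a ha).2 ((h z).1 hyz).symm)⟩)
  -- the component of `x`
  have hclosed : ∀ {a b}, (G.Adj x a ∨ Twin G x a) → H₀.Adj a b → (G.Adj x b ∨ Twin G x b) := by
    intro a b ha hab
    by_cases ha' : Twin G x a
    · exact .inl ((hP b ha').1 hab)
    · by_cases hb' : Twin G x b
      · exact .inr hb'
      · have := hfar.ball_closed htri ((hD ha').2 (ha.resolve_right ha')) ⟨hab, ha', hb'⟩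
        exact .inl ((hD hb').1 this)
  have hmulti : ∀ {p q r}, (G.Adj x p ∨ Twin G x p) → (G.Adj x q ∨ Twin G x q) →
      (G.Adj x r ∨ Twin G x r) → H₀.Adj p q → H₀.Adj r p ∨ H₀.Adj r q := by
    intro p q r hp hq hr hpq
    by_cases hr' : Twin G x r
    · rw [hP _ hr', hP _ hr']
      by_cases hp' : Twin G x p
      · exact .inr ((hP _ hp').1 hpq)
      · exact .inl (hp.resolve_right hp')
    · have hr'' := hr.resolve_right hr'
      by_cases hp' : Twin G x p
      · exact .inl ((hP _ hp').2 hr'').symm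
      · by_cases hq' : Twin G x q
        · exact .inr ((hP _ hq').2 hr'').symm
        · have := hfar.ball_multipartite htri ((hD hp').2 (hp.resolve_right hp'))
            ((hD hq').2 (hq.resolve_right hq')) ((hD hr').2 hr'') ⟨hpq, hp', hq'⟩
          exact this.imp (fun h => h.1) (fun h => h.1)
  intro p q s r hpq hps hqs hrs
  by_cases hs : G.Adj x s ∨ Twin G x s
  · exact hmulti (hclosed hs hps.symm) (hclosed hs hqs.symm) (hclosed hs hrs.symm) hpq
  · have hs' : ¬ Twin G x s := fun h => hs (.inr h)
    have hout : ∀ {a}, H₀.Adj a s → ¬ Twin G x a := fun ha h => hs (hclosed (.inr h) ha)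
    exact (hnoH₁ p q s r ⟨hpq, hout hps, hout hqs⟩ ⟨hps, hout hps, hs'⟩ ⟨hqs, hout hqs, hs'⟩
      ⟨hrs, hout hrs, hs'⟩).imp (fun h => h.1) (fun h => h.1)

theorem pawDeletable_isolate_iff {G : SimpleGraph V} {k : ℕ} {x : V} (hx : Isolatable G k x) :
    PawDeletable (isolate G x) k ↔ PawDeletable G k := by
  refine ⟨fun h => ?_, fun h => h.isolate x⟩
  obtain ⟨hx, h1 | h1 | h1 | h1⟩ := hx
  exacts [h.of_isolate_far h1, h.of_isolate_twins h1, h.of_isolate_coTwins hx h1.1 h1.2,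
    h.of_isolate_pendant h1]

/-- Vertices outside `touched A` in the same complete multipartite component that are
nonadjacent are twins in `G`. -/
theorem twin_of_not_touched {G : SimpleGraph V} {A : Finset (Sym2 V)}
    (hfree : NoPaw (G.deleteEdges (A : Set (Sym2 V)))) {m w w' : V}
    (hm : InTriangle (G.deleteEdges (A : Set (Sym2 V))) m)
    (hw : w ∈ ballTwo (G.deleteEdges (A : Set (Sym2 V))) m)
    (hw' : w' ∈ ballTwo (G.deleteEdges (A : Set (Sym2 V))) m)
    (hwA : w ∉ touched A) (hwA' : w' ∉ touched A) (h : ¬ G.Adj w w') : Twin G w w' := by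
  intro z
  rw [← adj_deleteEdges_of_not_touched hwA, ← adj_deleteEdges_of_not_touched hwA']
  exact (hfree.farFromPaws m).adj_iff_of_not_adj hm hw hw' (fun h' => h h'.1) z

/-- At least `3k + 2` of the counted vertices are untouched. If `uv` survives, they lie in one
complete multipartite component with `u` and `v`. Fix one of them, `w`: each is adjacent to `w`,
which holds for at most `2k`, or a twin of `w`, which holds for at most `k + 1`. -/
theorem ForcedEdge.mem_solution {G : SimpleGraph V} {k : ℕ} {u v : V} (h : ForcedEdge G k u v)
    {A : Finset (Sym2 V)} (hA : A.card ≤ k)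
    (hfree : NoPaw (G.deleteEdges (A : Set (Sym2 V)))) : s(u, v) ∈ A := by
  obtain ⟨huv, -, hno, hcard⟩ := h
  by_contra huvA
  set W := Finset.univ.filter fun w => G.Adj u w ∧ G.Adj v w ∧
      (Finset.univ.filter fun z => G.Adj w z ∧ G.Adj u z ∧ G.Adj v z).card ≤ 2 * k with hW
  have hM := card_touched_le A
  have h1 := Finset.le_card_sdiff (touched A) W
  obtain ⟨w, hw⟩ : (W \ touched A).Nonempty := Finset.card_pos.1 (by omega)
  obtain ⟨hwW, hwA⟩ := Finset.mem_sdiff.1 hw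
  obtain ⟨huw, hvw, hwcard⟩ := (Finset.mem_filter.1 hwW).2
  have hadj : ∀ a, a ∉ touched A → ∀ b, G.Adj b a →
      (G.deleteEdges (A : Set (Sym2 V))).Adj a b := fun a ha b hab =>
    (adj_deleteEdges_of_not_touched ha b).2 hab.symm
  have htri : InTriangle (G.deleteEdges (A : Set (Sym2 V))) w :=
    ⟨u, v, hadj w hwA u huw, hadj w hwA v hvw, by simp [huv, huvA]⟩
  have hsub : W \ touched A ⊆
      (Finset.univ.filter fun z => G.Adj w z ∧ G.Adj u z ∧ G.Adj v z) ∪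
        (Finset.univ.filter fun y => Twin G w y) := by
    intro a ha
    obtain ⟨haW, haA⟩ := Finset.mem_sdiff.1 ha
    obtain ⟨hua, hva, -⟩ := (Finset.mem_filter.1 haW).2
    simp only [Finset.mem_union, Finset.mem_filter, Finset.mem_univ, true_and]
    by_cases hwa : G.Adj w a
    · exact .inl ⟨hwa, hua, hva⟩
    · exact .inr (twin_of_not_touched hfree htri (self_mem_ballTwo _ _)
        (.inr (.inr ⟨u, hadj w hwA u huw, (hadj a haA u hua).symm⟩)) hwA haA hwa)
  have h2 := Finset.card_le_card hsub
  have h3 := Finset.card_union_le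
    (Finset.univ.filter fun z => G.Adj w z ∧ G.Adj u z ∧ G.Adj v z)
    (Finset.univ.filter fun y => Twin G w y)
  have h4 := card_twins_le hno ⟨u, huw.symm⟩
  omega

theorem pawDeletable_deleteEdges_iff {G : SimpleGraph V} {k : ℕ} {u v : V}
    (h : ForcedEdge G k u v) :
    PawDeletable (G.deleteEdges {s(u, v)}) (k - 1) ↔ PawDeletable G k := by
  constructor
  · rintro ⟨A, hA, hfree⟩
    refine ⟨insert s(u, v) A, (Finset.card_insert_le _ _).trans ?_, ?_⟩
    · have := h.2.1
      omega
    · rwa [SimpleGraph.deleteEdges_deleteEdges, Set.singleton_union, ← Finset.coe_insert] at hfree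
  · rintro ⟨A, hA, hfree⟩
    have hmem := h.mem_solution hA hfree
    refine ⟨A.erase s(u, v), ?_, ?_⟩
    · rw [Finset.card_erase_of_mem hmem]
      omega
    · rw [SimpleGraph.deleteEdges_deleteEdges, Set.singleton_union, ← Finset.coe_insert,
        Finset.insert_erase hmem]
      exact hfree

/-! ### Counting the vertices of a reduced yes-instance -/

/-- Within the component, a non-neighbour of `w` is untouched and hence a twin of `w`. So the
neighbours and twins of `w` make up the whole component, and the same holds for `w'`; if `w` and
`w'` are nonadjacent, they are twins outright. -/
theorem coTwin_of_not_touched {G : SimpleGraph V} {A : Finset (Sym2 V)}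
    (hfree : NoPaw (G.deleteEdges (A : Set (Sym2 V)))) {m w w' : V}
    (hm : InTriangle (G.deleteEdges (A : Set (Sym2 V))) m)
    (hw : w ∈ ballTwo (G.deleteEdges (A : Set (Sym2 V))) m)
    (hw' : w' ∈ ballTwo (G.deleteEdges (A : Set (Sym2 V))) m)
    (hwA : w ∉ touched A) (hwA' : w' ∉ touched A)
    (hwM : ∀ z ∈ touched A, z ∈ ballTwo (G.deleteEdges (A : Set (Sym2 V))) m → G.Adj w z)
    (hwM' : ∀ z ∈ touched A, z ∈ ballTwo (G.deleteEdges (A : Set (Sym2 V))) m → G.Adj w' z) :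
    CoTwin G w w' := by
  by_cases h : G.Adj w w'
  · have hfar := hfree.farFromPaws m
    have key : ∀ {a b}, a ∈ ballTwo (G.deleteEdges (A : Set (Sym2 V))) m →
        b ∈ ballTwo (G.deleteEdges (A : Set (Sym2 V))) m → a ∉ touched A → b ∉ touched A →
        (∀ z ∈ touched A, z ∈ ballTwo (G.deleteEdges (A : Set (Sym2 V))) m → G.Adj a z) →
        G.Adj a b → ∀ z, (G.Adj a z ∨ Twin G a z) ↔
          z ∈ ballTwo (G.deleteEdges (A : Set (Sym2 V))) m := by
      intro a b ha hb haA hbA haM hab z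
      constructor
      · rintro (h | h)
        · exact hfar.ball_closed hm ha ((adj_deleteEdges_of_not_touched haA z).2 h)
        · exact hfar.ball_closed hm hb
            ((adj_deleteEdges_of_not_touched hbA z).2 ((h b).1 hab).symm)
      · intro hz
        by_cases haz : G.Adj a z
        · exact .inl haz
        · exact .inr (twin_of_not_touched hfree hm ha hz haA (fun hz' => haz (haM z hz' hz)) haz)
    intro z
    rw [key hw hw' hwA hwA' hwM h, key hw' hw hwA' hwA hwM' h.symm]
  · have h := twin_of_not_touched hfree hm hw hw' hwA hwA' h
    intro z
    rw [h z]
    exact or_congr_right ⟨fun h' => h.symm.trans h', fun h' => h.trans h'⟩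

/-- An untouched component of `G - A` is a component of `G`. Being complete multipartite, it meets
no paw of `G`. -/
theorem exists_touched_of_inTriangle {G : SimpleGraph V} {A : Finset (Sym2 V)}
    (hfree : NoPaw (G.deleteEdges (A : Set (Sym2 V)))) {w : V}
    (hw : InTriangle (G.deleteEdges (A : Set (Sym2 V))) w) (hfar : ¬ FarFromPaws G w) :
    ∃ m ∈ touched A, m ∈ ballTwo (G.deleteEdges (A : Set (Sym2 V))) w := by
  by_contra! hcon
  apply hfar
  have hH := hfree.farFromPaws w
  have hadj : ∀ {a b}, a ∈ ballTwo (G.deleteEdges (A : Set (Sym2 V))) w → G.Adj a b →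
      (G.deleteEdges (A : Set (Sym2 V))).Adj a b := fun ha hab =>
    (adj_deleteEdges_of_not_touched (fun h => hcon _ h ha) _).2 hab
  have hcl : ∀ {a b}, a ∈ ballTwo (G.deleteEdges (A : Set (Sym2 V))) w → G.Adj a b →
      b ∈ ballTwo (G.deleteEdges (A : Set (Sym2 V))) w := fun ha hab =>
    hH.ball_closed hw ha (hadj ha hab)
  rintro p q s r hpq hps hqs hrs ⟨y, hy, hy'⟩
  have hyB : y ∈ ballTwo (G.deleteEdges (A : Set (Sym2 V))) w := by
    rcases hy with rfl | hy
    · exact self_mem_ballTwo _ _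
    · exact hcl (self_mem_ballTwo _ _) hy
  have hs : s ∈ ballTwo (G.deleteEdges (A : Set (Sym2 V))) w := by
    rcases hy' with rfl | rfl | rfl | rfl
    exacts [hcl hyB hps, hcl hyB hqs, hyB, hcl hyB hrs]
  have hp := hcl hs hps.symm
  exact (hH.ball_multipartite hw hp (hcl hs hqs.symm) (hcl hs hrs.symm) (hadj hp hpq)).imp
    (fun h => h.1) (fun h => h.1)

/-- Untouched vertices in triangles of `H` are split by whether they miss some touched vertex of
their component (`S₁`, all twins for a given one) or see all of them (`S₂`, all co-twins). `S₃`
receives those whose triangles in `G` are all destroyed, and `S₄` those in no triangle of `G`. -/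
theorem card_nonisolated_le {G : SimpleGraph V} {k : ℕ} (hred : ∀ x, ¬ Isolatable G k x)
    (hforced : ∀ u v, ¬ ForcedEdge G k u v) (hyes : PawDeletable G k) :
    (Finset.univ.filter fun x => ∃ y, G.Adj x y).card ≤
      2 * k + 2 * k * (6 * k + 4) + k * (5 * k + 1) +
        (2 * k + k * (5 * k + 1)) * (k + 1) := by
  obtain ⟨A, hsub, hA, hfree⟩ := hyes.exists_subset
  set M := touched A with hMdef
  have hM : M.card ≤ 2 * k := (card_touched_le A).trans (by omega)
  set H := G.deleteEdges (A : Set (Sym2 V)) with hH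
  have hno : ∀ y, ¬ ManyTwins G k y := fun y hy => hred y ⟨hy.1, .inr (.inl hy)⟩
  let S₁ := M.biUnion fun m => Finset.univ.filter fun w =>
    w ∉ M ∧ InTriangle H m ∧ w ∈ ballTwo H m ∧ ¬ G.Adj w m
  let S₂ := M.biUnion fun m => Finset.univ.filter fun w =>
    w ∉ M ∧ InTriangle H m ∧ w ∈ ballTwo H m ∧ ∀ z ∈ M, z ∈ ballTwo H m → G.Adj w z
  let S₃ := A.biUnion fun e => Finset.univ.filter fun w =>
    w ∉ M ∧ ¬ InTriangle H w ∧ ∀ u ∈ e, G.Adj u w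
  -- The last condition does not involve `w`: it empties the set for every `z` with too many such
  -- neighbours.
  let S₄ := (M ∪ S₃).biUnion fun z => Finset.univ.filter fun w =>
    (G.Adj z w ∧ ¬ InTriangle G w) ∧
      (Finset.univ.filter fun w => G.Adj z w ∧ ¬ InTriangle G w).card ≤ k + 1
  have hS₁ : S₁.card ≤ 2 * k * (k + 1) := by
    refine (Finset.card_biUnion_le_card_mul _ _ (k + 1) fun m hm => ?_).trans
      (Nat.mul_le_mul_right _ hM)
    rcases Finset.eq_empty_or_nonempty (Finset.univ.filter fun w =>
      w ∉ M ∧ InTriangle H m ∧ w ∈ ballTwo H m ∧ ¬ G.Adj w m) with h | ⟨w₀, hw₀⟩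
    · rw [h]; simp
    · obtain ⟨h1, h2, h3, h4⟩ := (Finset.mem_filter.1 hw₀).2
      obtain ⟨c, -, hc, -, -⟩ := (hfree.farFromPaws m).inTriangle_of_mem h2 h3
      refine (Finset.card_le_card fun w hw => ?_).trans (card_twins_le hno ⟨c, hc.1⟩)
      obtain ⟨h5, -, h6, h7⟩ := (Finset.mem_filter.1 hw).2
      refine Finset.mem_filter.2 ⟨Finset.mem_univ _,
        twin_of_not_touched hfree h2 h3 h6 h1 h5 fun h => ?_⟩
      rcases (hfree.farFromPaws m).ball_multipartite h2 h3 h6 (self_mem_ballTwo H m)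
        ((adj_deleteEdges_of_not_touched h1 w).2 h) with h' | h'
      exacts [h4 h'.1.symm, h7 h'.1.symm]
  have hS₂ : S₂.card ≤ 2 * k * (5 * k + 3) := by
    refine (Finset.card_biUnion_le_card_mul _ _ (5 * k + 3) fun m hm => ?_).trans
      (Nat.mul_le_mul_right _ hM)
    rcases Finset.eq_empty_or_nonempty (Finset.univ.filter fun w =>
      w ∉ M ∧ InTriangle H m ∧ w ∈ ballTwo H m ∧ ∀ z ∈ M, z ∈ ballTwo H m → G.Adj w z)
      with h | ⟨w₀, hw₀⟩
    · rw [h]; simp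
    · obtain ⟨h1, h2, h3, h4⟩ := (Finset.mem_filter.1 hw₀).2
      obtain ⟨c, -, hc, -, -⟩ := (hfree.farFromPaws m).inTriangle_of_mem h2 h3
      have hle : (Finset.univ.filter fun y => CoTwin G w₀ y).card ≤ 5 * k + 3 := by
        by_contra! h
        exact hred w₀ ⟨⟨c, hc.1⟩, .inr (.inr (.inl ⟨hno, h⟩))⟩
      refine (Finset.card_le_card fun w hw => ?_).trans hle
      obtain ⟨h5, -, h6, h7⟩ := (Finset.mem_filter.1 hw).2
      exact Finset.mem_filter.2 ⟨Finset.mem_univ _,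
        coTwin_of_not_touched hfree h2 h3 h6 h1 h5 h4 h7⟩
  have hS₃ : S₃.card ≤ k * (5 * k + 1) := by
    refine (Finset.card_biUnion_le_card_mul _ _ (5 * k + 1) fun e he => ?_).trans
      (Nat.mul_le_mul_right _ hA)
    have hk : 1 ≤ k := (Finset.card_pos.2 ⟨e, he⟩).trans_le hA
    have huv := hsub he
    induction e with | _ u v =>
    rw [SimpleGraph.mem_edgeSet] at huv
    have hle : (Finset.univ.filter fun w => G.Adj u w ∧ G.Adj v w ∧
      (Finset.univ.filter fun z => G.Adj w z ∧ G.Adj u z ∧ G.Adj v z).card ≤ 2 * k).card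
        ≤ 5 * k + 1 := by
      by_contra! h
      exact hforced u v ⟨huv, hk, hno, h⟩
    refine (Finset.card_le_card fun w hw => ?_).trans hle
    obtain ⟨h1, h2, h3⟩ := (Finset.mem_filter.1 hw).2
    have hu := h3 u (Sym2.mem_mk_left u v)
    have hv := h3 v (Sym2.mem_mk_right u v)
    refine Finset.mem_filter.2 ⟨Finset.mem_univ _, hu, hv,
      (Finset.card_le_card fun z hz => ?_).trans hM⟩
    obtain ⟨hwz, huz, -⟩ := (Finset.mem_filter.1 hz).2
    -- An untouched `z` would leave the triangle `w, z, u` intact in `H`. So all common neighbours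
    -- of `w`, `u`, `v` are touched, which is where the threshold `2k` in `ForcedEdge` comes from.
    by_contra hzM
    exact h2 ⟨z, u, (adj_deleteEdges_of_not_touched h1 z).2 hwz,
      (adj_deleteEdges_of_not_touched h1 u).2 hu.symm,
      (adj_deleteEdges_of_not_touched hzM u).2 huz.symm⟩
  have hS₄ : S₄.card ≤ (2 * k + k * (5 * k + 1)) * (k + 1) := by
    refine (Finset.card_biUnion_le_card_mul _ _ (k + 1) fun z hz => ?_).trans
      (Nat.mul_le_mul_right _ ((Finset.card_union_le _ _).trans (Nat.add_le_add hM hS₃)))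
    by_cases h : (Finset.univ.filter fun w => G.Adj z w ∧ ¬ InTriangle G w).card ≤ k + 1 <;>
      simp [h]
  have hmem₃ : ∀ w, w ∉ M → ¬ InTriangle H w → InTriangle G w → w ∈ S₃ := by
    rintro w hwM hwH ⟨y, z, hwy, hwz, hyz⟩
    have hmem : s(y, z) ∈ A := by
      by_contra hcon
      exact hwH ⟨y, z, (adj_deleteEdges_of_not_touched hwM y).2 hwy,
        (adj_deleteEdges_of_not_touched hwM z).2 hwz, by simp [hH, hyz, hcon]⟩
    refine Finset.mem_biUnion.2 ⟨_, hmem, Finset.mem_filter.2 ⟨Finset.mem_univ _, hwM, hwH, ?_⟩⟩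
    intro u hu
    rcases Sym2.mem_iff.1 hu with rfl | rfl
    exacts [hwy.symm, hwz.symm]
  have hcover : (Finset.univ.filter fun x => ∃ y, G.Adj x y) ⊆ M ∪ (S₁ ∪ S₂) ∪ S₃ ∪ S₄ := by
    intro w hw
    have hw := (Finset.mem_filter.1 hw).2
    simp only [Finset.mem_union]
    by_cases hwM : w ∈ M
    · exact .inl (.inl (.inl hwM))
    by_cases hwH : InTriangle H w
    · left; left; right
      obtain ⟨m, hm, hmw⟩ := exists_touched_of_inTriangle hfree hwH
        fun h => hred w ⟨hw, .inl h⟩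
      have hfar := hfree.farFromPaws w
      have hmt := hfar.inTriangle_of_mem hwH hmw
      by_cases hall : ∀ z ∈ M, z ∈ ballTwo H m → G.Adj w z
      · exact .inr (Finset.mem_biUnion.2 ⟨m, hm, Finset.mem_filter.2
          ⟨Finset.mem_univ _, hwM, hmt, mem_ballTwo_comm hmw, hall⟩⟩)
      · push Not at hall
        obtain ⟨z, hz, hzm, hwz⟩ := hall
        have hfar' := hfree.farFromPaws m
        exact .inl (Finset.mem_biUnion.2 ⟨z, hz, Finset.mem_filter.2
          ⟨Finset.mem_univ _, hwM, hfar'.inTriangle_of_mem hmt hzm,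
            hfar'.mem_ballTwo_of_mem hmt hzm (mem_ballTwo_comm hmw), hwz⟩⟩)
    · by_cases hwG : InTriangle G w
      · exact .inl (.inr (hmem₃ w hwM hwH hwG))
      · right
        have hpend : ¬ SuperfluousPendant G k w := fun h => hred w ⟨hw, .inr (.inr (.inr h))⟩
        rw [SuperfluousPendant] at hpend
        push Not at hpend
        obtain ⟨z, hwz, hz, hcard⟩ := hpend hwG
        refine Finset.mem_biUnion.2 ⟨z, ?_, Finset.mem_filter.2
          ⟨Finset.mem_univ _, ⟨hwz.symm, hwG⟩, by omega⟩⟩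
        rw [Finset.mem_union]
        by_cases hzM : z ∈ M
        · exact .inl hzM
        -- If the untouched `z` were in a triangle of `H`, so would be `w`, which lies in the same
        -- complete multipartite component.
        · refine .inr (hmem₃ z hzM (fun h => hwH ?_) hz)
          exact (hfree.farFromPaws z).inTriangle_of_mem h
            (.inr (.inl ((adj_deleteEdges_of_not_touched hzM w).2 hwz.symm)))
  have hunion : (M ∪ (S₁ ∪ S₂) ∪ S₃ ∪ S₄).card ≤
      M.card + (S₁.card + S₂.card) + S₃.card + S₄.card :=
    (Finset.card_union_le _ _).trans (Nat.add_le_add_right ((Finset.card_union_le _ _).trans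
      (Nat.add_le_add_right ((Finset.card_union_le _ _).trans
        (Nat.add_le_add_left (Finset.card_union_le _ _) _)) _)) _)
  calc _ ≤ _ := Finset.card_le_card hcover
    _ ≤ _ := hunion
    _ ≤ 2 * k + (2 * k * (k + 1) + 2 * k * (5 * k + 3)) + k * (5 * k + 1) +
        (2 * k + k * (5 * k + 1)) * (k + 1) := by gcongr
    _ = _ := by ring

end Rules

/-! ### Programs for bounded arithmetic terms -/

namespace RAM

/-- Started in `s`, the program `p` halts after at most `c` steps in a state satisfying `Q`. -/
def Runs (p : Prog) (s : State) (c : ℕ) (Q : State → Prop) : Prop :=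
  ∃ s' t, Exec p s s' t ∧ t ≤ c ∧ Q s'

@[simp] theorem State.setReg_reg (s : State) (x v y : ℕ) :
    (s.setReg x v).reg y = if y = x then v else s.reg y := by
  simp [State.setReg, Function.update_apply]

@[simp] theorem State.setReg_arr (s : State) (x v : ℕ) : (s.setReg x v).arr = s.arr := rfl

@[simp] theorem State.setArr_reg (s : State) (a i j v : ℕ) : (s.setArr a i j v).reg = s.reg := rfl

theorem Runs.mono {p : Prog} {s : State} {c c' : ℕ} {Q Q' : State → Prop} (h : Runs p s c Q)
    (hc : c ≤ c') (hQ : ∀ s', Q s' → Q' s') : Runs p s c' Q' := by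
  obtain ⟨s', t, h1, h2, h3⟩ := h
  exact ⟨s', t, h1, h2.trans hc, hQ _ h3⟩

theorem Runs.seq {p q : Prog} {s : State} {c c' : ℕ} {Q R : State → Prop} (h : Runs p s c Q)
    (h' : ∀ s', Q s' → Runs q s' c' R) : Runs (.seq p q) s (c + c') R := by
  obtain ⟨s', t, h1, h2, h3⟩ := h
  obtain ⟨s'', t', h4, h5, h6⟩ := h' s' h3
  exact ⟨s'', t + t', .seq h1 h4, Nat.add_le_add h2 h5, h6⟩

theorem Runs.assign {x : ℕ} {e : Expr} {s : State} {Q : State → Prop}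
    (h : Q (s.setReg x (e.eval s))) : Runs (.assign x e) s (e.cost + 1) Q :=
  ⟨_, _, .assign x e s, le_rfl, h⟩

theorem Runs.store {a : ℕ} {i j e : Expr} {s : State} {Q : State → Prop}
    (h : Q (s.setArr a (i.eval s) (j.eval s) (e.eval s))) :
    Runs (.store a i j e) s (i.cost + j.cost + e.cost + 1) Q :=
  ⟨_, _, .store a i j e s, le_rfl, h⟩

theorem Runs.ite {e : Expr} {p q : Prog} {s : State} {c : ℕ} {Q : State → Prop}
    (h : e.eval s ≠ 0 → Runs p s c Q) (h' : e.eval s = 0 → Runs q s c Q) :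
    Runs (.ite e p q) s (e.cost + 1 + c) Q := by
  by_cases he : e.eval s = 0
  · obtain ⟨s', t, h1, h2, h3⟩ := h' he
    exact ⟨s', _, .ite_false he h1, Nat.add_le_add_left h2 _, h3⟩
  · obtain ⟨s', t, h1, h2, h3⟩ := h he
    exact ⟨s', _, .ite_true he h1, Nat.add_le_add_left h2 _, h3⟩

/-- Run `p` for all values of the register `x` below the contents of register `0`; finally
reset `x`. -/
def forLoop (x : ℕ) (p : Prog) : Prog :=
  .seq (.assign x (.const 0)) (.seq
    (.loop (.sub (.reg 0) (.reg x)) (.seq p (.assign x (.add (.reg x) (.const 1)))))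
    (.assign x (.const 0)))

/-- The test and the increment cost four steps each, whence `c + 8`; the final test and the two
assignments of `0` give the last `8`. The counter leaves the loop with value `n`, so the invariant
describes the state before the reset. -/
theorem Runs.forLoop {x : ℕ} {p : Prog} {s : State} {n c : ℕ} (I : ℕ → State → Prop)
    (h0 : I 0 (s.setReg x 0)) (hI : ∀ i s', I i s' → s'.reg 0 = n ∧ s'.reg x = i)
    (hstep : ∀ i s', i < n → I i s' →
      Runs p s' c fun s'' => I (i + 1) (s''.setReg x (s''.reg x + 1))) :
    Runs (forLoop x p) s (n * (c + 8) + 8) fun s' => ∃ s'', I n s'' ∧ s' = s''.setReg x 0 := by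
  have hloop : ∀ m i s', i + m = n → I i s' →
      Runs (.loop (.sub (.reg 0) (.reg x)) (.seq p (.assign x (.add (.reg x) (.const 1)))))
        s' (m * (c + 8) + 4) (I n) := by
    intro m
    induction m with
    | zero =>
      intro i s' him hi
      obtain ⟨h1, h2⟩ := hI i s' hi
      refine ⟨s', _, .loop_done ?_, ?_, ?_⟩
      · simp only [Expr.eval, h1, h2]; omega
      · simp [Expr.cost]
      · rwa [← show i = n by omega]
    | succ m ih =>
      intro i s' him hi
      obtain ⟨h1, h2⟩ := hI i s' hi
      have hbody : Runs (.seq p (.assign x (.add (.reg x) (.const 1)))) s' (c + 4) (I (i + 1)) :=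
        (hstep i s' (by omega) hi).seq fun s'' h => Runs.assign h
      obtain ⟨s₁, t₁, h3, h4, h5⟩ := hbody
      obtain ⟨s₂, t₂, h6, h7, h8⟩ := ih (i + 1) s₁ (by omega) h5
      refine ⟨s₂, _, .loop_step ?_ h3 h6, ?_, h8⟩
      · simp only [Expr.eval, h1, h2]; omega
      · simp only [Expr.cost]
        have : (m + 1) * (c + 8) = m * (c + 8) + (c + 8) := by ring
        omega
  have := (Runs.assign (x := x) (e := .const 0) (s := s) (Q := I 0) h0).seq fun s' h =>
    (hloop n 0 s' (Nat.zero_add n) h).seq fun s'' h' =>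
      Runs.assign (x := x) (e := .const 0) (Q := fun s' => ∃ s'', I n s'' ∧ s' = s''.setReg x 0)
        ⟨s'', h', rfl⟩
  exact this.mono (by simp only [Expr.cost]; omega) fun _ h => h

/-- Arithmetic terms with bounded sums. Sums are over all values below `size`. -/
inductive Term where
  | const (c : ℕ)
  | size
  | par
  | var (x : ℕ)
  | arr (t u : Term)
  | add (t u : Term)
  | sub (t u : Term)
  | ite (c t u : Term)
  | sum (x : ℕ) (t : Term)

namespace Term

/-- The value of a term, where the array `a` is read. -/
def eval (a : ℕ) : Term → State → ℕ
  | .const c, _ => c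
  | .size, s => s.reg 0
  | .par, s => s.reg 2
  | .var x, s => s.reg (2 * x + 4)
  | .arr t u, s => s.arr a (t.eval a s) (u.eval a s)
  | .add t u, s => t.eval a s + u.eval a s
  | .sub t u, s => t.eval a s - u.eval a s
  | .ite c t u, s => if c.eval a s ≠ 0 then t.eval a s else u.eval a s
  | .sum x t, s => ∑ i ∈ Finset.range (s.reg 0), t.eval a (s.setReg (2 * x + 4) i)

/-- A program that computes a term and puts the result into the register `2 * d + 3`; it uses the
odd registers from there on as scratch memory. -/
def compile (a : ℕ) : Term → ℕ → Prog
  | .const c, d => .assign (2 * d + 3) (.const c)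
  | .size, d => .assign (2 * d + 3) (.reg 0)
  | .par, d => .assign (2 * d + 3) (.reg 2)
  | .var x, d => .assign (2 * d + 3) (.reg (2 * x + 4))
  | .arr t u, d => .seq (t.compile a d) (.seq (u.compile a (d + 1))
      (.assign (2 * d + 3) (.arr a (.reg (2 * d + 3)) (.reg (2 * (d + 1) + 3)))))
  | .add t u, d => .seq (t.compile a d) (.seq (u.compile a (d + 1))
      (.assign (2 * d + 3) (.add (.reg (2 * d + 3)) (.reg (2 * (d + 1) + 3)))))
  | .sub t u, d => .seq (t.compile a d) (.seq (u.compile a (d + 1))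
      (.assign (2 * d + 3) (.sub (.reg (2 * d + 3)) (.reg (2 * (d + 1) + 3)))))
  | .ite c t u, d => .seq (c.compile a d)
      (.ite (.reg (2 * d + 3)) (t.compile a d) (u.compile a d))
  | .sum x t, d => .seq (.assign (2 * d + 3) (.const 0)) (.seq
      (.assign (2 * (d + 1) + 3) (.reg (2 * x + 4))) (.seq
      (forLoop (2 * x + 4) (.seq (t.compile a (d + 2))
        (.assign (2 * d + 3) (.add (.reg (2 * d + 3)) (.reg (2 * (d + 2) + 3))))))
      (.assign (2 * x + 4) (.reg (2 * (d + 1) + 3)))))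

/-- A bound for the running time of `compile`, as a polynomial in `size`. -/
noncomputable def cost : Term → Polynomial ℕ
  | .const _ => 2
  | .size => 2
  | .par => 2
  | .var _ => 2
  | .arr t u => t.cost + u.cost + 4
  | .add t u => t.cost + u.cost + 4
  | .sub t u => t.cost + u.cost + 4
  | .ite c t u => c.cost + t.cost + u.cost + 2
  | .sum _ t => Polynomial.X * (t.cost + 12) + 14

/-- Size, parameter and variables live in even registers, scratch memory in odd ones. Computing one
subterm therefore does not disturb the value of another. -/
theorem eval_congr (a : ℕ) (t : Term) : ∀ {s s' : State}, (∀ r, s.reg (2 * r) = s'.reg (2 * r)) →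
    s.arr a = s'.arr a → t.eval a s = t.eval a s' := by
  induction t with
  | const c => intros; rfl
  | size => intro s s' h _; exact h 0
  | par => intro s s' h _; exact h 1
  | var x => intro s s' h _; exact h (x + 2)
  | arr t u iht ihu => intro s s' h h'; simp only [eval, iht h h', ihu h h', h']
  | add t u iht ihu => intro s s' h h'; simp only [eval, iht h h', ihu h h']
  | sub t u iht ihu => intro s s' h h'; simp only [eval, iht h h', ihu h h']
  | ite c t u ihc iht ihu => intro s s' h h'; simp only [eval, ihc h h', iht h h', ihu h h']
  | sum x t ih =>
    intro s s' h h'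
    simp only [eval, show s.reg 0 = s'.reg 0 from h 0]
    refine Finset.sum_congr rfl fun i _ => ih (fun r => ?_) h'
    simp only [State.setReg_reg, h]

/-- `s'` arises from `s` by writing `v` into the register `2 * d + 3` and anything into the odd
registers behind it. -/
def Computed (d : ℕ) (s : State) (v : ℕ) (s' : State) : Prop :=
  s'.reg (2 * d + 3) = v ∧ s'.arr = s.arr ∧
    ∀ r, (r % 2 = 0 ∨ r < 2 * d + 3) → s'.reg r = s.reg r

theorem computed_setReg {d : ℕ} {s s' : State} (v : ℕ) (h : s'.arr = s.arr)
    (h' : ∀ r, (r % 2 = 0 ∨ r < 2 * d + 3) → s'.reg r = s.reg r) :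
    Computed d s v (s'.setReg (2 * d + 3) v) := by
  refine ⟨by simp, h, fun r hr => ?_⟩
  rw [State.setReg_reg, if_neg (by omega), h' r hr]

theorem runs_compile_binary {a d : ℕ} {t u : Term} {s : State} {ct cu : ℕ} {e : Expr}
    (f : State → ℕ → ℕ → ℕ)
    (ht : Runs (t.compile a d) s ct (Computed d s (t.eval a s)))
    (hu : ∀ s', s'.reg 0 = s.reg 0 →
      Runs (u.compile a (d + 1)) s' cu (Computed (d + 1) s' (u.eval a s')))
    (he : ∀ s', s'.arr = s.arr →
      e.eval s' = f s (s'.reg (2 * d + 3)) (s'.reg (2 * (d + 1) + 3)))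
    (hcost : e.cost = 3) :
    Runs (.seq (t.compile a d) (.seq (u.compile a (d + 1)) (.assign (2 * d + 3) e))) s
      (ct + cu + 4) (Computed d s (f s (t.eval a s) (u.eval a s))) := by
  refine (ht.seq fun s₁ ⟨h1, h2, h3⟩ => (hu s₁ (h3 0 (.inl rfl))).seq fun s₂ ⟨h4, h5, h6⟩ =>
    Runs.assign ?_).mono (by rw [hcost]; omega) fun _ h => h
  have hev : u.eval a s₁ = u.eval a s :=
    u.eval_congr a (fun r => h3 _ (.inl (by omega))) (by rw [h2])
  rw [he s₂ (h5.trans h2), h4, h6 _ (.inr (by omega)), h1, hev]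
  exact computed_setReg _ (h5.trans h2) fun r hr => by
    rw [h6 r (by omega), h3 r hr]

theorem runs_compile (a : ℕ) (t : Term) : ∀ (d : ℕ) (s : State),
    Runs (t.compile a d) s (t.cost.eval (s.reg 0)) (Computed d s (t.eval a s)) := by
  induction t with
  | const c | size | par | var x =>
    intro d s
    refine (Runs.assign (computed_setReg _ rfl fun _ _ => rfl)).mono ?_ fun _ h => h
    simp [Expr.cost, cost]
  | arr t u iht ihu =>
    intro d s
    simpa [cost, compile, eval] using runs_compile_binary (fun s x y => s.arr a x y) (iht d s)
      (fun s' h => h ▸ ihu (d + 1) s') (fun s' h => by simp [Expr.eval, h]) rfl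
  | add t u iht ihu =>
    intro d s
    simpa [cost, compile, eval] using runs_compile_binary (fun _ x y => x + y) (iht d s)
      (fun s' h => h ▸ ihu (d + 1) s') (fun s' h => by simp [Expr.eval]) rfl
  | sub t u iht ihu =>
    intro d s
    simpa [cost, compile, eval] using runs_compile_binary (fun _ x y => x - y) (iht d s)
      (fun s' h => h ▸ ihu (d + 1) s') (fun s' h => by simp [Expr.eval]) rfl
  | ite c t u ihc iht ihu =>
    intro d s
    have hbranch : ∀ (w : Term) (s₁ : State), Computed d s (c.eval a s) s₁ →
        Runs (w.compile a d) s₁ (w.cost.eval (s.reg 0)) (Computed d s₁ (w.eval a s₁)) →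
        Runs (w.compile a d) s₁ (w.cost.eval (s.reg 0)) (Computed d s (w.eval a s)) := by
      rintro w s₁ ⟨-, h2, h3⟩ h
      have hev : w.eval a s₁ = w.eval a s :=
        w.eval_congr a (fun r => h3 _ (.inl (by omega))) (by rw [h2])
      refine h.mono le_rfl fun s₂ ⟨h4, h5, h6⟩ => ⟨h4.trans hev, h5.trans h2, fun r hr => ?_⟩
      rw [h6 r hr, h3 r hr]
    refine ((ihc d s).seq (c' := 2 + (t.cost.eval (s.reg 0) + u.cost.eval (s.reg 0)))
      fun s₁ h => ?_).mono (by simp [cost]; omega) fun _ h => h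
    have hn : s₁.reg 0 = s.reg 0 := h.2.2 0 (.inl rfl)
    have hc : (Expr.reg (2 * d + 3)).eval s₁ = c.eval a s := h.1
    refine Runs.ite (fun h0 => ?_) (fun h0 => ?_)
    · rw [hc] at h0
      simp only [eval, h0, ne_eq, not_false_eq_true, if_true]
      exact (hbranch t s₁ h (hn ▸ iht d s₁)).mono (by omega) fun _ h => h
    · rw [hc] at h0
      simp only [eval, h0, ne_eq, not_true_eq_false, if_false]
      exact (hbranch u s₁ h (hn ▸ ihu d s₁)).mono (by omega) fun _ h => h
  | sum x t ih =>
    intro d s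
    set n := s.reg 0 with hn
    set v := 2 * x + 4 with hv
    -- Register `2 * d + 3` accumulates the sum, the next odd one keeps the old value of the bound
    -- variable, to be restored at the end, and the summand is computed behind them.
    let I : ℕ → State → Prop := fun i s' => s'.reg v = i ∧
      s'.reg (2 * d + 3) = ∑ j ∈ Finset.range i, t.eval a (s.setReg v j) ∧
      s'.reg (2 * (d + 1) + 3) = s.reg v ∧ s'.arr = s.arr ∧
      ∀ r, r ≠ v → (r % 2 = 0 ∨ r < 2 * d + 3) → s'.reg r = s.reg r
    have hfor : Runs (RAM.forLoop v (.seq (t.compile a (d + 2))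
        (.assign (2 * d + 3) (.add (.reg (2 * d + 3)) (.reg (2 * (d + 2) + 3))))))
        ((s.setReg (2 * d + 3) 0).setReg (2 * (d + 1) + 3) (s.reg v))
        (n * (t.cost.eval n + 4 + 8) + 8) fun s' => ∃ s'', I n s'' ∧ s' = s''.setReg v 0 := by
      refine Runs.forLoop I ?_ ?_ ?_
      · refine ⟨by simp, ?_, ?_, rfl, fun r hr hr' => ?_⟩
        · rw [State.setReg_reg, if_neg (by omega), State.setReg_reg, if_neg (by omega)]
          simp
        · rw [State.setReg_reg, if_neg (by omega)]
          simp
        · rw [State.setReg_reg, if_neg hr, State.setReg_reg, if_neg (by omega),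
            State.setReg_reg, if_neg (by omega)]
      · rintro i s' ⟨h1, -, -, -, h5⟩
        exact ⟨h5 0 (by omega) (.inl rfl), h1⟩
      · rintro i s' hi ⟨h1, h2, h3, h4, h5⟩
        have h0 : s'.reg 0 = n := h5 0 (by omega) (.inl rfl)
        refine (h0 ▸ ih (d + 2) s').seq fun s₁ ⟨h6, h7, h8⟩ => Runs.assign ?_
        have hev : t.eval a s' = t.eval a (s.setReg v i) := by
          refine t.eval_congr a (fun r => ?_) (by rw [h4]; rfl)
          rw [State.setReg_reg]
          split_ifs with hr
          · rw [hr, h1]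
          · exact h5 _ hr (.inl (by omega))
        refine ⟨?_, ?_, ?_, ?_, fun r hr hr' => ?_⟩
        · simp only [State.setReg_reg, if_true, if_neg (show v ≠ 2 * d + 3 by omega)]
          rw [h8 v (.inl (by omega)), h1]
        · simp only [State.setReg_reg, if_true, if_neg (show 2 * d + 3 ≠ v by omega), Expr.eval]
          rw [Finset.sum_range_succ, h6, h8 _ (.inr (by omega)), h2, hev]
        · rw [State.setReg_reg, if_neg (by omega), State.setReg_reg, if_neg (by omega),
            h8 _ (.inr (by omega)), h3]
        · simp [h7, h4]
        · rw [State.setReg_reg, if_neg hr, State.setReg_reg, if_neg (by omega),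
            h8 r (by omega), h5 r hr hr']
    refine (Runs.seq (Runs.assign (Q := fun s' => s' = s.setReg (2 * d + 3) 0) rfl) ?_).mono
      (c := 2 + (2 + ((n * (t.cost.eval n + 4 + 8) + 8) + 2))) ?_ fun _ h => h
    · rintro _ rfl
      refine Runs.seq (Runs.assign (Q := fun s' => s' =
        ((s.setReg (2 * d + 3) 0).setReg (2 * (d + 1) + 3) (s.reg v))) ?_) ?_
      · simp only [Expr.eval, State.setReg_reg, ← hv, if_neg (show v ≠ 2 * d + 3 by omega)]
      · rintro _ rfl
        refine hfor.seq ?_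
        rintro _ ⟨s₁, ⟨h1, h2, h3, h4, h5⟩, rfl⟩
        refine Runs.assign ⟨?_, h4, fun r hr => ?_⟩
        · rw [State.setReg_reg, if_neg (by omega), State.setReg_reg, if_neg (by omega), h2]
          rfl
        · simp only [State.setReg_reg, Expr.eval]
          by_cases hrv : r = v
          · rw [if_pos hrv, if_neg (by omega), h3, hrv]
          · rw [if_neg hrv, if_neg hrv, h5 r hrv hr]
    · simp [cost]
      ring_nf
      omega

end Term

/-- Fill the square upper left part of the array `dst` with the values of the term `t`, in which
the variables `0` and `1` stand for the row and the column and which reads the array `a`. -/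
def fill (a dst : ℕ) (t : Term) : Prog :=
  forLoop 4 (forLoop 6 (.seq (t.compile a 0) (.store dst (.reg 4) (.reg 6) (.reg 3))))

/-- A bound for the running time of `fill`. -/
noncomputable def fillCost (t : Term) : Polynomial ℕ :=
  Polynomial.X * (Polynomial.X * (t.cost + 12) + 16) + 8

/-- The result of `fill`. -/
structure Filled (a dst : ℕ) (t : Term) (s s' : State) : Prop where
  reg : ∀ r, r % 2 = 0 → r ≠ 4 → r ≠ 6 → s'.reg r = s.reg r
  reg_four : s'.reg 4 = 0
  reg_six : s'.reg 6 = 0 ∨ s'.reg 6 = s.reg 6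
  arr_of_ne : ∀ b, b ≠ dst → s'.arr b = s.arr b
  arr : ∀ i < s.reg 0, ∀ j < s.reg 0,
    s'.arr dst i j = t.eval a ((s.setReg 4 i).setReg 6 j)

/-- As `a` and `dst` differ, every entry is computed from the old matrix. Register `6` keeps its old
value only if the inner loop is never started. -/
theorem runs_fill {a dst : ℕ} (hdst : a ≠ dst) (t : Term) (s : State) :
    Runs (fill a dst t) s ((fillCost t).eval (s.reg 0)) (Filled a dst t s) := by
  set n := s.reg 0 with hn
  let g : ℕ → ℕ → ℕ := fun i j => t.eval a ((s.setReg 4 i).setReg 6 j)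
  let I : ℕ → State → Prop := fun i s' => s'.reg 4 = i ∧
    (∀ r, r % 2 = 0 → r ≠ 4 → r ≠ 6 → s'.reg r = s.reg r) ∧
    (s'.reg 6 = 0 ∨ s'.reg 6 = s.reg 6) ∧ (∀ b, b ≠ dst → s'.arr b = s.arr b) ∧
    ∀ i' < i, ∀ j < n, s'.arr dst i' j = g i' j
  let J : ℕ → ℕ → State → Prop := fun i j s' => s'.reg 6 = j ∧ s'.reg 4 = i ∧
    (∀ r, r % 2 = 0 → r ≠ 4 → r ≠ 6 → s'.reg r = s.reg r) ∧
    (∀ b, b ≠ dst → s'.arr b = s.arr b) ∧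
    (∀ i' < i, ∀ j' < n, s'.arr dst i' j' = g i' j') ∧ ∀ j' < j, s'.arr dst i j' = g i j'
  have hfor : Runs (fill a dst t) s (n * ((n * ((t.cost.eval n + 4) + 8) + 8) + 8) + 8)
      fun s' => ∃ s'', I n s'' ∧ s' = s''.setReg 4 0 := by
    refine Runs.forLoop I ?_ ?_ ?_
    · refine ⟨by simp, fun r _ h4 _ => by simp [h4], .inr (by simp), fun _ _ => rfl, ?_⟩
      intro i hi
      omega
    · rintro i s' ⟨h1, h2, -⟩
      exact ⟨h2 0 rfl (by omega) (by omega), h1⟩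
    · rintro i s' hi ⟨h1, h2, -, h4, h5⟩
      refine (Runs.forLoop (J i) (n := n) (c := t.cost.eval n + 4) ?_ ?_ ?_).mono le_rfl ?_
      · refine ⟨by simp, by simp [h1], fun r hr hr4 hr6 => by simp [hr6, h2 r hr hr4 hr6], h4, h5,
          fun j hj => by omega⟩
      · rintro j s' ⟨h1, -, h2, -⟩
        exact ⟨h2 0 rfl (by omega) (by omega), h1⟩
      · rintro j s₁ hj ⟨h6, h7, h8, h9, h10, h11⟩
        have h0 : s₁.reg 0 = n := h8 0 rfl (by omega) (by omega)
        refine (h0 ▸ t.runs_compile a 0 s₁).seq fun s₂ ⟨h12, h13, h14⟩ => Runs.store ?_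
        have hev : t.eval a s₁ = g i j := by
          refine t.eval_congr a (fun r => ?_) (h9 a hdst)
          simp only [State.setReg_reg]
          split_ifs with h h'
          · rw [h, h6]
          · rw [h', h7]
          · exact h8 _ (by omega) h' h
        have e6 : s₂.reg 6 = j := by rw [h14 6 (.inl rfl), h6]
        have e4 : s₂.reg 4 = i := by rw [h14 4 (.inl rfl), h7]
        have e3 : s₂.reg 3 = g i j := h12.trans hev
        refine ⟨by simp [e6], by simp [e4], fun r hr hr4 hr6 => ?_, fun b hb => ?_,
          fun i' hi' j' hj' => ?_, fun j' hj' => ?_⟩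
        · simp [hr6, h14 r (.inl hr), h8 r hr hr4 hr6]
        · simp only [State.setReg_arr, State.setArr, hb, false_and, if_false, h13]
          exact h9 b hb
        · simp only [State.setReg_arr, State.setArr, Expr.eval, e4, e6, h13]
          rw [if_neg (fun h => hi'.ne h.2.1)]
          exact h10 i' hi' j' hj'
        · simp only [State.setReg_arr, State.setArr, Expr.eval, e4, e6, e3, h13]
          split_ifs with h
          · rw [h.2.2]
          · exact h11 j' ((Nat.lt_succ_iff_lt_or_eq.1 hj').resolve_right
              fun h' => h ⟨trivial, trivial, h'⟩)
      · rintro _ ⟨s₁, ⟨h6, h7, h8, h9, h10, h11⟩, rfl⟩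
        refine ⟨by simp [h7], fun r hr hr4 hr6 => by simp [hr4, hr6, h8 r hr hr4 hr6],
          .inl (by simp), h9, fun i' hi' j' hj' => ?_⟩
        rcases Nat.lt_succ_iff_lt_or_eq.1 hi' with h | rfl
        · exact h10 i' h j' hj'
        · exact h11 j' hj'
  refine hfor.mono ?_ ?_
  · simp [fillCost]
    ring_nf
    omega
  · rintro _ ⟨s₁, ⟨h1, h2, h3, h4, h5⟩, rfl⟩
    exact ⟨fun r hr hr4 hr6 => by simp [hr4, h2 r hr hr4 hr6], by simp, by simpa using h3, h4, h5⟩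

end RAM

/-! ### Graph properties as terms -/

namespace RAM

open Classical

/-- The memory `s` holds the instance `(G, k)`, and the variables are vertices. -/
structure Represents {n : ℕ} (G : SimpleGraph (Fin n)) (k : ℕ) (ρ : ℕ → Fin n) (s : State) :
    Prop where
  size : s.reg 0 = n
  par : s.reg 2 = k
  var : ∀ x, s.reg (2 * x + 4) = ρ x
  arr : ∀ i j : Fin n, s.arr 0 i j = if G.Adj i j then 1 else 0

theorem Represents.set {n : ℕ} {G : SimpleGraph (Fin n)} {k : ℕ} {ρ : ℕ → Fin n} {s : State}
    (h : Represents G k ρ s) (x : ℕ) (i : Fin n) :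
    Represents G k (Function.update ρ x i) (s.setReg (2 * x + 4) i) := by
  refine ⟨by simp [h.size], by simp [h.par], fun y => ?_, h.arr⟩
  by_cases hy : y = x
  · simp [hy]
  · simp [hy, h.var]

namespace Term

section

variable {n : ℕ} (G : SimpleGraph (Fin n)) (k : ℕ)

/-- The term `t` has the value `F ρ` under the assignment `ρ`. -/
def Computes (t : Term) (F : (ℕ → Fin n) → ℕ) : Prop :=
  ∀ ρ s, Represents G k ρ s → t.eval 0 s = F ρ

/-- The term `t` is nonzero exactly under the assignments satisfying `P`. -/
def Defines (t : Term) (P : (ℕ → Fin n) → Prop) : Prop :=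
  ∀ ρ s, Represents G k ρ s → (t.eval 0 s ≠ 0 ↔ P ρ)

end

/-! ### Connectives, quantifiers and counting; nonzero values count as true -/

def and (t u : Term) : Term := .ite t u (.const 0)
def or (t u : Term) : Term := .ite t (.const 1) u
def imp (t u : Term) : Term := .ite t u (.const 1)
def not (t : Term) : Term := .ite t (.const 0) (.const 1)
def lt (t u : Term) : Term := .sub u t
def le (t u : Term) : Term := .not (.lt u t)
def eq (t u : Term) : Term := .and (.le t u) (.le u t)
def iff (t u : Term) : Term := .ite t u (.not u)
-- A sum of natural numbers is nonzero exactly if some summand is.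
def ex (x : ℕ) (t : Term) : Term := .sum x t
def all (x : ℕ) (t : Term) : Term := .not (.ex x (.not t))
def count (x : ℕ) (t : Term) : Term := .sum x (.ite t (.const 1) (.const 0))
def adj (x y : ℕ) : Term := .arr (.var x) (.var y)

/-- A multiple of a term. -/
def smul : ℕ → Term → Term
  | 0, _ => .const 0
  | m + 1, t => .add (smul m t) t

variable {n : ℕ} {G : SimpleGraph (Fin n)} {k : ℕ} {t u : Term} {P Q : (ℕ → Fin n) → Prop}
  {F F' : (ℕ → Fin n) → ℕ}

theorem Defines.congr (h : Defines G k t P) (h' : ∀ ρ, P ρ ↔ Q ρ) : Defines G k t Q :=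
  fun ρ s hs => (h ρ s hs).trans (h' ρ)

theorem Computes.congr (h : Computes G k t F) (h' : ∀ ρ, F ρ = F' ρ) : Computes G k t F' :=
  fun ρ s hs => (h ρ s hs).trans (h' ρ)

theorem Defines.and (h : Defines G k t P) (h' : Defines G k u Q) :
    Defines G k (t.and u) fun ρ => P ρ ∧ Q ρ := fun ρ s hs => by
  beta_reduce
  rw [← h ρ s hs, ← h' ρ s hs]
  by_cases h0 : t.eval 0 s = 0 <;> simp [Term.and, eval, h0]

theorem Defines.or (h : Defines G k t P) (h' : Defines G k u Q) :
    Defines G k (t.or u) fun ρ => P ρ ∨ Q ρ := fun ρ s hs => by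
  beta_reduce
  rw [← h ρ s hs, ← h' ρ s hs]
  by_cases h0 : t.eval 0 s = 0 <;> simp [Term.or, eval, h0]

theorem Defines.imp (h : Defines G k t P) (h' : Defines G k u Q) :
    Defines G k (t.imp u) fun ρ => P ρ → Q ρ := fun ρ s hs => by
  beta_reduce
  rw [← h ρ s hs, ← h' ρ s hs]
  by_cases h0 : t.eval 0 s = 0 <;> simp [Term.imp, eval, h0]

theorem Defines.iff (h : Defines G k t P) (h' : Defines G k u Q) :
    Defines G k (t.iff u) fun ρ => (P ρ ↔ Q ρ) := fun ρ s hs => by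
  beta_reduce
  rw [← h ρ s hs, ← h' ρ s hs]
  by_cases h0 : t.eval 0 s = 0 <;> simp [Term.iff, Term.not, eval, h0]

theorem Defines.not (h : Defines G k t P) : Defines G k t.not fun ρ => ¬ P ρ := fun ρ s hs => by
  beta_reduce
  rw [← h ρ s hs]
  by_cases h0 : t.eval 0 s = 0 <;> simp [Term.not, eval, h0]

theorem Computes.lt (h : Computes G k t F) (h' : Computes G k u F') :
    Defines G k (t.lt u) fun ρ => F ρ < F' ρ := fun ρ s hs => by
  simp only [Term.lt, eval, h ρ s hs, h' ρ s hs]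
  omega

theorem Computes.le (h : Computes G k t F) (h' : Computes G k u F') :
    Defines G k (t.le u) fun ρ => F ρ ≤ F' ρ :=
  (h'.lt h).not.congr fun _ => not_lt

theorem Computes.eq (h : Computes G k t F) (h' : Computes G k u F') :
    Defines G k (t.eq u) fun ρ => F ρ = F' ρ :=
  ((h.le h').and (h'.le h)).congr fun _ => le_antisymm_iff.symm

theorem eval_ex_ne_zero {s : State} (hs : s.reg 0 = n) (x : ℕ) (t : Term) :
    (ex x t).eval 0 s ≠ 0 ↔ ∃ i : Fin n, t.eval 0 (s.setReg (2 * x + 4) i) ≠ 0 := by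
  simp [ex, eval, hs, Fin.exists_iff]

theorem Defines.ex (x : ℕ) (h : Defines G k t P) :
    Defines G k (ex x t) fun ρ => ∃ i, P (Function.update ρ x i) := fun ρ s hs => by
  rw [eval_ex_ne_zero hs.size]
  exact exists_congr fun i => h _ _ (hs.set x i)

theorem Defines.all (x : ℕ) (h : Defines G k t P) :
    Defines G k (all x t) fun ρ => ∀ i, P (Function.update ρ x i) :=
  (h.not.ex x).not.congr fun ρ => by simp

theorem eval_count {s : State} (hs : s.reg 0 = n) (x : ℕ) (t : Term) :
    (count x t).eval 0 s =
      (Finset.univ.filter fun i : Fin n => t.eval 0 (s.setReg (2 * x + 4) i) ≠ 0).card := by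
  simp only [count, eval, hs, Finset.card_filter]
  rw [Finset.sum_range]

theorem Defines.count (x : ℕ) (h : Defines G k t P) :
    Computes G k (count x t) fun ρ =>
      (Finset.univ.filter fun i => P (Function.update ρ x i)).card := fun ρ s hs => by
  rw [eval_count hs.size]
  congr 1
  exact Finset.filter_congr fun i _ => h _ _ (hs.set x i)

theorem computes_const (c : ℕ) : Computes G k (const c) fun _ => c := fun _ _ _ => rfl

theorem computes_par : Computes G k par fun _ => k := fun _ _ hs => hs.par

theorem computes_var (x : ℕ) : Computes G k (var x) fun ρ => ρ x := fun _ _ hs => hs.var x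

theorem Computes.add (h : Computes G k t F) (h' : Computes G k u F') :
    Computes G k (t.add u) fun ρ => F ρ + F' ρ := fun ρ s hs => by
  simp only [eval, h ρ s hs, h' ρ s hs]

theorem eval_smul (m : ℕ) (t : Term) (a : ℕ) (s : State) :
    (smul m t).eval a s = m * t.eval a s := by
  induction m with
  | zero => simp [smul, eval]
  | succ m ih => simp only [smul, eval, ih]; ring

theorem Computes.smul (m : ℕ) (h : Computes G k t F) :
    Computes G k (smul m t) fun ρ => m * F ρ := fun ρ s hs => by
  rw [eval_smul, h ρ s hs]

theorem defines_adj (x y : ℕ) : Defines G k (adj x y) fun ρ => G.Adj (ρ x) (ρ y) :=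
  fun ρ s hs => by
  simp only [adj, eval, hs.var, hs.arr]
  split_ifs with h <;> simp [h]

theorem defines_eq_var (x y : ℕ) : Defines G k (eq (var x) (var y)) fun ρ => ρ x = ρ y :=
  ((computes_var x).eq (computes_var y)).congr fun _ => Fin.val_inj

/-- Quantified variables have numbers from `10` on. -/
def inTriangle (x : ℕ) : Term := .ex 10 (.ex 11 (.and (adj x 10) (.and (adj x 11) (adj 10 11))))

/-- Bound variables have fixed numbers, so here and below the hypotheses on `x` exclude capture. -/
theorem defines_inTriangle {x : ℕ} (h : x ≠ 10) (h' : x ≠ 11) :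
    Defines G k (inTriangle x) fun ρ => InTriangle G (ρ x) :=
  ((((defines_adj x 10).and ((defines_adj x 11).and (defines_adj 10 11))).ex 11).ex 10).congr
    fun ρ => by simp [InTriangle, h, h']

def farFromPaws (x : ℕ) : Term :=
  .all 10 (.all 11 (.all 12 (.all 13 (.imp (adj 10 11) (.imp (adj 10 12) (.imp (adj 11 12)
    (.imp (adj 13 12) (.imp (.ex 14 (.and (.or (.eq (.var 14) (.var x)) (adj x 14))
      (.or (.eq (.var 14) (.var 10)) (.or (.eq (.var 14) (.var 11))
        (.or (.eq (.var 14) (.var 12)) (.eq (.var 14) (.var 13)))))))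
      (.or (adj 13 10) (adj 13 11))))))))))

theorem defines_farFromPaws {x : ℕ} (h : x < 10) :
    Defines G k (farFromPaws x) fun ρ => FarFromPaws G (ρ x) :=
  ((((((defines_adj 10 11).imp ((defines_adj 10 12).imp ((defines_adj 11 12).imp
    ((defines_adj 13 12).imp (((((defines_eq_var 14 x).or (defines_adj x 14)).and
      ((defines_eq_var 14 10).or ((defines_eq_var 14 11).or ((defines_eq_var 14 12).or
        (defines_eq_var 14 13))))).ex 14).imp
          ((defines_adj 13 10).or (defines_adj 13 11))))))).all 13).all 12).all 11).all 10).congr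
    fun ρ => by
      have : x ≠ 10 ∧ x ≠ 11 ∧ x ≠ 12 ∧ x ≠ 13 ∧ x ≠ 14 := by omega
      simp [FarFromPaws, this]

def twin (x y : ℕ) : Term := .all 14 (.iff (adj x 14) (adj y 14))

theorem defines_twin {x y : ℕ} (h : x ≠ 14) (h' : y ≠ 14) :
    Defines G k (twin x y) fun ρ => Twin G (ρ x) (ρ y) :=
  (((defines_adj x 14).iff (defines_adj y 14)).all 14).congr fun ρ => by simp [Twin, h, h']

def coTwin (x y : ℕ) : Term :=
  .all 15 (.iff (.or (adj x 15) (twin x 15)) (.or (adj y 15) (twin y 15)))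

theorem defines_coTwin {x y : ℕ} (h : x < 14) (h' : y < 14) :
    Defines G k (coTwin x y) fun ρ => CoTwin G (ρ x) (ρ y) := by
  have hx : x ≠ 14 ∧ x ≠ 15 := by omega
  have hy : y ≠ 14 ∧ y ≠ 15 := by omega
  exact ((((defines_adj x 15).or (defines_twin hx.1 (by norm_num))).iff
    ((defines_adj y 15).or (defines_twin hy.1 (by norm_num)))).all 15).congr
    fun ρ => by simp [CoTwin, hx, hy]

def hasNeighbor (x : ℕ) : Term := .ex 10 (adj x 10)

theorem defines_hasNeighbor {x : ℕ} (h : x ≠ 10) :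
    Defines G k (hasNeighbor x) fun ρ => ∃ y, G.Adj (ρ x) y :=
  ((defines_adj x 10).ex 10).congr fun ρ => by simp [h]

def manyTwins (x : ℕ) : Term :=
  .and (hasNeighbor x) (.le (.add .par (.const 2)) (.count 11 (twin x 11)))

theorem defines_manyTwins {x : ℕ} (h : x ≠ 10) (h' : x ≠ 11) (h'' : x ≠ 14) :
    Defines G k (manyTwins x) fun ρ => ManyTwins G k (ρ x) :=
  ((defines_hasNeighbor h).and ((computes_par.add (computes_const 2)).le
    ((defines_twin h'' (by norm_num)).count 11))).congr fun ρ => by simp [ManyTwins, h']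

def superfluousPendant (x : ℕ) : Term :=
  .and (.not (inTriangle x)) (.all 12 (.imp (adj x 12) (.imp (inTriangle 12)
    (.le (.add .par (.const 2)) (.count 13 (.and (adj 12 13) (.not (inTriangle 13))))))))

theorem defines_superfluousPendant {x : ℕ} (h : x < 10) :
    Defines G k (superfluousPendant x) fun ρ => SuperfluousPendant G k (ρ x) := by
  have hx : x ≠ 10 ∧ x ≠ 11 ∧ x ≠ 12 := by omega
  exact ((defines_inTriangle hx.1 hx.2.1).not.and (((defines_adj x 12).imp
    ((defines_inTriangle (by norm_num) (by norm_num)).imp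
      ((computes_par.add (computes_const 2)).le (((defines_adj 12 13).and
        (defines_inTriangle (by norm_num) (by norm_num)).not).count 13)))).all 12)).congr
    fun ρ => by simp [SuperfluousPendant, hx]

def isolatable (x : ℕ) : Term :=
  .and (hasNeighbor x) (.or (farFromPaws x) (.or (manyTwins x) (.or
    (.and (.all 12 (.not (manyTwins 12)))
      (.le (.add (.smul 5 .par) (.const 4)) (.count 13 (coTwin x 13))))
    (superfluousPendant x))))

theorem defines_isolatable {x : ℕ} (h : x < 10) :
    Defines G k (isolatable x) fun ρ => Isolatable G k (ρ x) := by
  have hx : x ≠ 10 ∧ x ≠ 11 ∧ x ≠ 13 ∧ x ≠ 14 := by omega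
  exact ((defines_hasNeighbor hx.1).and ((defines_farFromPaws h).or
    ((defines_manyTwins hx.1 hx.2.1 hx.2.2.2).or ((((defines_manyTwins (by norm_num)
      (by norm_num) (by norm_num)).not.all 12).and (((computes_par.smul 5).add
        (computes_const 4)).le ((defines_coTwin (by omega) (by norm_num)).count 13))).or
          (defines_superfluousPendant h))))).congr
    fun ρ => by simp [Isolatable, hx]

def forcedEdge (x y : ℕ) : Term :=
  .and (adj x y) (.and (.le (.const 1) .par) (.and (.all 12 (.not (manyTwins 12)))
    (.le (.add (.smul 5 .par) (.const 2)) (.count 13 (.and (adj x 13) (.and (adj y 13)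
      (.le (.count 14 (.and (adj 13 14) (.and (adj x 14) (adj y 14)))) (.smul 2 .par))))))))

theorem defines_forcedEdge {x y : ℕ} (h : x < 10) (h' : y < 10) :
    Defines G k (forcedEdge x y) fun ρ => ForcedEdge G k (ρ x) (ρ y) := by
  have hx : x ≠ 13 ∧ x ≠ 14 := by omega
  have hy : y ≠ 13 ∧ y ≠ 14 := by omega
  exact ((defines_adj x y).and (((computes_const 1).le computes_par).and
    (((defines_manyTwins (by norm_num) (by norm_num) (by norm_num)).not.all 12).and
      (((computes_par.smul 5).add (computes_const 2)).le (((defines_adj x 13).and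
        ((defines_adj y 13).and ((((defines_adj 13 14).and ((defines_adj x 14).and
          (defines_adj y 14))).count 14).le (computes_par.smul 2)))).count 13))))).congr
    fun ρ => by simp [ForcedEdge, hx, hy]

end Term

end RAM

/-! ### One reduction step -/

section Steps

open Classical

variable {n : ℕ}

/-- `x` is the first vertex that a reduction rule allows to isolate. -/
def FirstIsolatable (G : SimpleGraph (Fin n)) (k : ℕ) (x : Fin n) : Prop :=
  Isolatable G k x ∧ ∀ y, Isolatable G k y → (x : ℕ) ≤ y

/-- `(u, v)` is the lexicographically first forced edge. -/
def FirstForced (G : SimpleGraph (Fin n)) (k : ℕ) (u v : Fin n) : Prop :=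
  ForcedEdge G k u v ∧ ∀ u' v', ForcedEdge G k u' v' → (u : ℕ) < u' ∨ (u = u' ∧ (v : ℕ) ≤ v')

/-- Isolate the first vertex for which this is allowed. -/
def isolateStep (G : SimpleGraph (Fin n)) (k : ℕ) : SimpleGraph (Fin n) where
  Adj a b := G.Adj a b ∧ ¬ FirstIsolatable G k a ∧ ¬ FirstIsolatable G k b
  symm := ⟨fun _ _ h => ⟨h.1.symm, h.2.2, h.2.1⟩⟩
  loopless := ⟨fun _ h => h.1.ne rfl⟩

/-- Delete the first forced edge. -/
def forcedStep (G : SimpleGraph (Fin n)) (k : ℕ) : SimpleGraph (Fin n) where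
  Adj a b := G.Adj a b ∧ ¬ FirstForced G k a b ∧ ¬ FirstForced G k b a
  symm := ⟨fun _ _ h => ⟨h.1.symm, h.2.2, h.2.1⟩⟩
  loopless := ⟨fun _ h => h.1.ne rfl⟩

/-- The parameter after the deletion of a forced edge, if there is one. -/
noncomputable def forcedPar (G : SimpleGraph (Fin n)) (k : ℕ) : ℕ :=
  if ∃ u v, ForcedEdge G k u v then k - 1 else k

/-- Only the first vertex may be isolated: isolating a whole class of twins at once would not be
safe. -/
theorem isolateStep_cases (G : SimpleGraph (Fin n)) (k : ℕ) :
    ((∀ x, ¬ Isolatable G k x) ∧ isolateStep G k = G) ∨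
      ∃ x, Isolatable G k x ∧ isolateStep G k = isolate G x := by
  by_cases h : ∃ x, Isolatable G k x
  · right
    obtain ⟨x, hx, hmin⟩ := (Set.toFinite {x | Isolatable G k x}).exists_minimal h
    have hfirst : ∀ y, FirstIsolatable G k y ↔ y = x := by
      intro y
      constructor
      · rintro ⟨hy, hy'⟩
        exact le_antisymm (hy' x hx) (hmin hy (hy' x hx))
      · rintro rfl
        exact ⟨hx, fun z hz => (le_total y z).elim id fun h => hmin hz h⟩
    refine ⟨x, hx, ?_⟩
    ext a b
    simp [isolateStep, hfirst]
  · left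
    push Not at h
    refine ⟨h, ?_⟩
    ext a b
    simp [isolateStep, FirstIsolatable, h]

theorem forcedStep_cases (G : SimpleGraph (Fin n)) (k : ℕ) :
    ((∀ u v, ¬ ForcedEdge G k u v) ∧ forcedStep G k = G ∧ forcedPar G k = k) ∨
      ∃ u v, ForcedEdge G k u v ∧ forcedStep G k = G.deleteEdges {s(u, v)} ∧
        forcedPar G k = k - 1 := by
  by_cases h : ∃ u v, ForcedEdge G k u v
  · right
    obtain ⟨u, hu, hmin⟩ := (Set.toFinite {u | ∃ v, ForcedEdge G k u v}).exists_minimal h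
    obtain ⟨v, hv, hmin'⟩ := (Set.toFinite {v | ForcedEdge G k u v}).exists_minimal hu
    have hfirst : ∀ a b, FirstForced G k a b ↔ a = u ∧ b = v := by
      intro a b
      constructor
      · rintro ⟨hab, hab'⟩
        have hua : a = u := by
          rcases hab' u v hv with h1 | h1
          · exact le_antisymm h1.le (hmin ⟨b, hab⟩ h1.le)
          · exact h1.1
        subst hua
        have hbv : (b : ℕ) ≤ v := by simpa using hab' a v hv
        exact ⟨rfl, le_antisymm hbv (hmin' hab hbv)⟩
      · rintro ⟨rfl, rfl⟩
        refine ⟨hv, fun u' v' h' => ?_⟩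
        rcases lt_trichotomy a u' with h1 | rfl | h1
        · exact .inl h1
        · exact .inr ⟨rfl, (le_total b v').elim id fun h => hmin' h' h⟩
        · exact absurd (hmin ⟨v', h'⟩ h1.le) (not_le.2 h1)
    refine ⟨u, v, hv, ?_, if_pos h⟩
    ext a b
    simp only [forcedStep, hfirst, SimpleGraph.deleteEdges_adj, Set.mem_singleton_iff,
      Sym2.eq_iff]
    tauto
  · left
    have h' : ∀ u v, ¬ ForcedEdge G k u v := fun u v huv => h ⟨u, v, huv⟩
    refine ⟨h', ?_, if_neg h⟩
    ext a b
    simp [forcedStep, FirstForced, h']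

/-- One step of the reduction. -/
noncomputable def reductionStep (p : SimpleGraph (Fin n) × ℕ) : SimpleGraph (Fin n) × ℕ :=
  (forcedStep (isolateStep p.1 p.2) p.2, forcedPar (isolateStep p.1 p.2) p.2)

/-- No reduction rule applies. -/
def Reduced (p : SimpleGraph (Fin n) × ℕ) : Prop :=
  (∀ x, ¬ Isolatable p.1 p.2 x) ∧ ∀ u v, ¬ ForcedEdge p.1 p.2 u v

/-- The number of ordered pairs of adjacent vertices. -/
noncomputable def arcCount (G : SimpleGraph (Fin n)) : ℕ :=
  (Finset.univ.filter fun p : Fin n × Fin n => G.Adj p.1 p.2).card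

theorem arcCount_lt {G H : SimpleGraph (Fin n)} (h : H ≤ G) {a b : Fin n} (hG : G.Adj a b)
    (hH : ¬ H.Adj a b) : arcCount H < arcCount G := by
  refine Finset.card_lt_card (Finset.ssubset_iff_subset_ne.2 ⟨fun p hp => ?_, fun heq => ?_⟩)
  · exact Finset.mem_filter.2 ⟨Finset.mem_univ _, h (Finset.mem_filter.1 hp).2⟩
  · have : (a, b) ∈ Finset.univ.filter fun p : Fin n × Fin n => H.Adj p.1 p.2 := by
      rw [heq]; simpa using hG
    exact hH (Finset.mem_filter.1 this).2

theorem forcedStep_le (G : SimpleGraph (Fin n)) (k : ℕ) : forcedStep G k ≤ G :=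
  fun _ _ h => h.1

theorem arcCount_mono {G H : SimpleGraph (Fin n)} (h : H ≤ G) : arcCount H ≤ arcCount G :=
  Finset.card_le_card fun _ hp =>
    Finset.mem_filter.2 ⟨Finset.mem_univ _, h (Finset.mem_filter.1 hp).2⟩

theorem reductionStep_progress (p : SimpleGraph (Fin n) × ℕ) :
    (Reduced p ∧ reductionStep p = p) ∨ arcCount (reductionStep p).1 < arcCount p.1 := by
  rcases isolateStep_cases p.1 p.2 with ⟨h1, h2⟩ | ⟨x, ⟨⟨y, hxy⟩, -⟩, h2⟩
  · rcases forcedStep_cases p.1 p.2 with ⟨h3, h4, h5⟩ | ⟨u, v, h3, h4, -⟩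
    · left
      exact ⟨⟨h1, h3⟩, by simp [reductionStep, h2, h4, h5]⟩
    · right
      simp only [reductionStep, h2, h4]
      exact arcCount_lt (SimpleGraph.deleteEdges_le _) h3.1 (by simp)
  · right
    refine (arcCount_mono (forcedStep_le _ _)).trans_lt ?_
    rw [h2]
    exact arcCount_lt (fun _ _ h => h.1) hxy (by simp)

theorem pawDeletable_reductionStep (p : SimpleGraph (Fin n) × ℕ) :
    (PawDeletable (reductionStep p).1 (reductionStep p).2 ↔ PawDeletable p.1 p.2) ∧
      (reductionStep p).2 ≤ p.2 := by
  have h1 : PawDeletable (isolateStep p.1 p.2) p.2 ↔ PawDeletable p.1 p.2 := by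
    rcases isolateStep_cases p.1 p.2 with ⟨-, h⟩ | ⟨x, hx, h⟩
    · rw [h]
    · rw [h, pawDeletable_isolate_iff hx]
  rw [← h1]
  rcases forcedStep_cases (isolateStep p.1 p.2) p.2 with ⟨-, h2, h3⟩ | ⟨u, v, huv, h2, h3⟩
  · simp [reductionStep, h2, h3]
  · simp only [reductionStep, h2, h3]
    exact ⟨pawDeletable_deleteEdges_iff huv, Nat.sub_le _ _⟩

theorem pawDeletable_iterate (p : SimpleGraph (Fin n) × ℕ) (m : ℕ) :
    (PawDeletable (reductionStep^[m] p).1 (reductionStep^[m] p).2 ↔ PawDeletable p.1 p.2) ∧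
      (reductionStep^[m] p).2 ≤ p.2 := by
  induction m with
  | zero => simp
  | succ m ih =>
    rw [Function.iterate_succ_apply']
    obtain ⟨h1, h2⟩ := pawDeletable_reductionStep (reductionStep^[m] p)
    exact ⟨h1.trans ih.1, h2.trans ih.2⟩

/-- There are at most `n * n` arcs, and each round loses one unless the pair is reduced and stays
fixed. With no arcs left, no rule applies, since each requires an edge. -/
theorem reduced_iterate (p : SimpleGraph (Fin n) × ℕ) : Reduced (reductionStep^[n * n] p) := by
  have key : ∀ m, Reduced (reductionStep^[m] p) ∨
      arcCount (reductionStep^[m] p).1 + m ≤ arcCount p.1 := by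
    intro m
    induction m with
    | zero => simp
    | succ m ih =>
      rw [Function.iterate_succ_apply']
      rcases reductionStep_progress (reductionStep^[m] p) with ⟨h1, h2⟩ | h
      · rw [h2]; exact .inl h1
      · rcases ih with ih | ih
        · rcases reductionStep_progress (reductionStep^[m] p) with ⟨h1, h2⟩ | h
          · rw [h2]; exact .inl h1
          · exfalso
            rcases isolateStep_cases (reductionStep^[m] p).1 (reductionStep^[m] p).2 with
              ⟨-, h2⟩ | ⟨x, hx, -⟩
            · rcases forcedStep_cases (reductionStep^[m] p).1 (reductionStep^[m] p).2 with
                ⟨-, h4, -⟩ | ⟨u, v, h3, -⟩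
              · simp [reductionStep, h2, h4] at h
              · exact ih.2 u v h3
            · exact ih.1 x hx
        · right; omega
  rcases key (n * n) with h | h
  · exact h
  · have hle : arcCount p.1 ≤ n * n := by
      refine (Finset.card_filter_le _ _).trans ?_
      simp
    have h0 : arcCount (reductionStep^[n * n] p).1 = 0 := by omega
    have hno : ∀ a b, ¬ (reductionStep^[n * n] p).1.Adj a b := by
      intro a b hab
      rw [arcCount, Finset.card_eq_zero] at h0
      have : (a, b) ∈ (Finset.univ.filter fun q : Fin n × Fin n =>
          (reductionStep^[n * n] p).1.Adj q.1 q.2) := by simpa using hab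
      rw [h0] at this
      simp at this
    exact ⟨fun x hx => hx.1.elim (hno x), fun u v huv => hno u v huv.1⟩

/-! ### Removing isolated vertices -/

/-- The number of nonisolated vertices before `x`. -/
noncomputable def rank (G : SimpleGraph (Fin n)) (x : Fin n) : ℕ :=
  (Finset.univ.filter fun y : Fin n => (y : ℕ) < x ∧ ∃ z, G.Adj y z).card

/-- The number of nonisolated vertices. -/
noncomputable def supportCard (G : SimpleGraph (Fin n)) : ℕ :=
  (Finset.univ.filter fun y : Fin n => ∃ z, G.Adj y z).card

theorem rank_lt_rank {G : SimpleGraph (Fin n)} {x y : Fin n} (hx : ∃ z, G.Adj x z)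
    (hxy : x < y) : rank G x < rank G y := by
  refine Finset.card_lt_card (Finset.ssubset_iff_subset_ne.2 ⟨fun z hz => ?_, fun heq => ?_⟩)
  · obtain ⟨h1, h2⟩ := (Finset.mem_filter.1 hz).2
    exact Finset.mem_filter.2 ⟨Finset.mem_univ _, h1.trans hxy, h2⟩
  · have : x ∈ Finset.univ.filter fun z : Fin n => (z : ℕ) < x ∧ ∃ w, G.Adj z w := by
      rw [heq]; exact Finset.mem_filter.2 ⟨Finset.mem_univ _, hxy, hx⟩
    exact lt_irrefl _ (Finset.mem_filter.1 this).2.1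

theorem rank_injective {G : SimpleGraph (Fin n)} {x y : Fin n} (hx : ∃ z, G.Adj x z)
    (hy : ∃ z, G.Adj y z) (h : rank G x = rank G y) : x = y := by
  rcases lt_trichotomy x y with h' | h' | h'
  · exact absurd h (rank_lt_rank hx h').ne
  · exact h'
  · exact absurd h (rank_lt_rank hy h').ne'

theorem rank_lt_supportCard {G : SimpleGraph (Fin n)} {x : Fin n} (hx : ∃ z, G.Adj x z) :
    rank G x < supportCard G := by
  refine Finset.card_lt_card (Finset.ssubset_iff_subset_ne.2 ⟨fun z hz => ?_, fun heq => ?_⟩)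
  · exact Finset.mem_filter.2 ⟨Finset.mem_univ _, (Finset.mem_filter.1 hz).2.2⟩
  · have : x ∈ Finset.univ.filter fun z : Fin n => (z : ℕ) < x ∧ ∃ w, G.Adj z w := by
      rw [heq]; exact Finset.mem_filter.2 ⟨Finset.mem_univ _, hx⟩
    exact lt_irrefl _ (Finset.mem_filter.1 this).2.1

/-- The rank maps the nonisolated vertices injectively into a range of the same cardinality, hence
onto it. -/
theorem exists_rank_eq {G : SimpleGraph (Fin n)} (a : Fin (supportCard G)) :
    ∃ x, (∃ z, G.Adj x z) ∧ rank G x = a := by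
  have hsub : (Finset.univ.filter fun y : Fin n => ∃ z, G.Adj y z).image (rank G) ⊆
      Finset.range (supportCard G) := by
    intro m hm
    obtain ⟨x, hx, rfl⟩ := Finset.mem_image.1 hm
    exact Finset.mem_range.2 (rank_lt_supportCard (Finset.mem_filter.1 hx).2)
  have hcard : ((Finset.univ.filter fun y : Fin n => ∃ z, G.Adj y z).image (rank G)).card =
      supportCard G := by
    refine Finset.card_image_of_injOn fun x hx y hy h => ?_
    exact rank_injective (Finset.mem_filter.1 hx).2 (Finset.mem_filter.1 hy).2 h
  have heq := Finset.eq_of_subset_of_card_le hsub (by rw [hcard, Finset.card_range])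
  have ha : (a : ℕ) ∈ (Finset.univ.filter fun y : Fin n => ∃ z, G.Adj y z).image (rank G) := by
    rw [heq]; exact Finset.mem_range.2 a.2
  obtain ⟨x, hx, h⟩ := Finset.mem_image.1 ha
  exact ⟨x, (Finset.mem_filter.1 hx).2, h⟩

/-- The graph without its isolated vertices. -/
def compactGraph (G : SimpleGraph (Fin n)) : SimpleGraph (Fin (supportCard G)) where
  Adj a b := ∃ u v, G.Adj u v ∧ rank G u = a ∧ rank G v = b
  symm := ⟨fun _ _ ⟨u, v, h, hu, hv⟩ => ⟨v, u, h.symm, hv, hu⟩⟩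
  loopless := ⟨fun _ ⟨u, v, h, hu, hv⟩ =>
    h.ne (rank_injective ⟨v, h⟩ ⟨u, h.symm⟩ (hu.trans hv.symm))⟩

/-- Solutions are pushed forward and pulled back along `σ`. All four vertices of a paw have
neighbours, so every paw of `G` lies in the range of `σ`. -/
theorem pawDeletable_iff_of_embedding {V W : Type*} {G : SimpleGraph V} {G' : SimpleGraph W}
    (σ : G' ↪g G) (hσ : ∀ x y, G.Adj x y → x ∈ Set.range σ) (k : ℕ) :
    PawDeletable G' k ↔ PawDeletable G k := by
  have hinj : Function.Injective (Sym2.map σ) := Sym2.map.injective σ.injective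
  constructor
  · rintro ⟨A, hA, hfree⟩
    refine ⟨A.image (Sym2.map σ), Finset.card_image_le.trans hA, ?_⟩
    have key : ∀ a b, (G.deleteEdges ((A.image (Sym2.map σ) : Finset (Sym2 V)) :
        Set (Sym2 V))).Adj (σ a) (σ b) ↔ (G'.deleteEdges (A : Set (Sym2 W))).Adj a b := by
      intro a b
      simp only [SimpleGraph.deleteEdges_adj, SimpleGraph.Embedding.map_adj_iff, Finset.mem_coe,
        ← Sym2.map_mk, Finset.mem_image, hinj.eq_iff, exists_eq_right]
    intro p q s r hpq hps hqs hrs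
    obtain ⟨p, rfl⟩ := hσ _ _ hpq.1
    obtain ⟨q, rfl⟩ := hσ _ _ hqs.1
    obtain ⟨s, rfl⟩ := hσ _ _ hps.1.symm
    obtain ⟨r, rfl⟩ := hσ _ _ hrs.1
    rw [key] at hpq hps hqs hrs
    rw [key, key]
    exact hfree p q s r hpq hps hqs hrs
  · rintro ⟨A, hA, hfree⟩
    refine ⟨A.preimage (Sym2.map σ) hinj.injOn, ?_, ?_⟩
    · refine (Finset.card_le_card_of_injOn (Sym2.map σ) (fun e he => ?_) hinj.injOn).trans hA
      simpa using he
    · intro p q s r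
      simpa using hfree (σ p) (σ q) (σ s) (σ r)

theorem pawDeletable_compactGraph (G : SimpleGraph (Fin n)) (k : ℕ) :
    PawDeletable (compactGraph G) k ↔ PawDeletable G k := by
  choose σ hσ hσ' using fun a => exists_rank_eq (G := G) a
  refine pawDeletable_iff_of_embedding
    ⟨⟨σ, fun a b h => Fin.ext (by rw [← hσ' a, ← hσ' b, h])⟩, fun {a b} => ?_⟩
    (fun x y hxy => ?_) k
  · constructor
    · intro h
      exact ⟨_, _, h, hσ' a, hσ' b⟩
    · rintro ⟨u, v, h, hu, hv⟩
      have h1 := rank_injective ⟨v, h⟩ (hσ a) (hu.trans (hσ' a).symm)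
      have h2 := rank_injective ⟨u, h.symm⟩ (hσ b) (hv.trans (hσ' b).symm)
      subst h1 h2
      exact h
  · have hx : ∃ z, G.Adj x z := ⟨y, hxy⟩
    refine ⟨⟨rank G x, rank_lt_supportCard hx⟩, rank_injective (hσ _) hx (hσ' _)⟩

theorem not_pawDeletable_paw : ¬ PawDeletable paw 0 := by
  rintro ⟨A, hA, hfree⟩
  obtain rfl : A = ∅ := Finset.card_eq_zero.1 (Nat.le_zero.1 hA)
  rw [Finset.coe_empty, SimpleGraph.deleteEdges_empty, ← isPawFree_iff_noPaw] at hfree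
  exact hfree ⟨SimpleGraph.Embedding.refl⟩

/-- The bound of `card_nonisolated_le` expands to `5k³ + 25k² + 14k`, and `5 + 25 + 14 = 44`. -/
theorem supportCard_le_of_reduced {p : SimpleGraph (Fin n) × ℕ} (h : Reduced p)
    (hyes : PawDeletable p.1 p.2) : supportCard p.1 ≤ 44 * p.2 ^ 3 := by
  have hle := card_nonisolated_le h.1 h.2 hyes
  refine (le_of_eq_of_le (by rw [supportCard]; congr!) hle).trans ?_
  rcases Nat.eq_zero_or_pos p.2 with h0 | h0
  · simp [h0]
  · nlinarith [Nat.mul_le_mul h0 h0, Nat.mul_le_mul h0 (Nat.mul_le_mul h0 h0),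
      Nat.mul_le_mul (Nat.mul_le_mul h0 h0) (le_refl p.2), Nat.mul_le_mul h0 (le_refl p.2),
      Nat.mul_le_mul h0 (Nat.mul_le_mul (le_refl p.2) (le_refl p.2))]

end Steps

/-! ### The kernelization program -/

namespace RAM

open Classical Term

variable {n : ℕ} {G G' : SimpleGraph (Fin n)} {k k' : ℕ} {ρ : ℕ → Fin n} {s s' : State}

namespace Term

def firstIsolatable (x : ℕ) : Term :=
  .and (isolatable x) (.all 2 (.imp (isolatable 2) (.le (.var x) (.var 2))))

theorem defines_firstIsolatable {x : ℕ} (h : x < 2) :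
    Defines G k (firstIsolatable x) fun ρ => FirstIsolatable G k (ρ x) :=
  ((defines_isolatable (by omega)).and (((defines_isolatable (by norm_num)).imp
    ((computes_var x).le (computes_var 2))).all 2)).congr
    fun ρ => by simp [FirstIsolatable, h.ne]

def firstForced (x y : ℕ) : Term :=
  .and (forcedEdge x y) (.all 2 (.all 3 (.imp (forcedEdge 2 3) (.or (.lt (.var x) (.var 2))
    (.and (.eq (.var x) (.var 2)) (.le (.var y) (.var 3)))))))

theorem defines_firstForced {x y : ℕ} (hx : x < 2) (hy : y < 2) :
    Defines G k (firstForced x y) fun ρ => FirstForced G k (ρ x) (ρ y) := by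
  have hx' : x ≠ 2 ∧ x ≠ 3 := by omega
  have hy' : y ≠ 2 ∧ y ≠ 3 := by omega
  exact ((defines_forcedEdge (by omega) (by omega)).and ((((defines_forcedEdge (by norm_num)
    (by norm_num)).imp (((computes_var x).lt (computes_var 2)).or ((defines_eq_var x 2).and
      ((computes_var y).le (computes_var 3))))).all 3).all 2)).congr
    fun ρ => by simp [FirstForced, hx', hy']

def isolateStep : Term :=
  .and (adj 0 1) (.and (.not (firstIsolatable 0)) (.not (firstIsolatable 1)))

theorem defines_isolateStep :
    Defines G k isolateStep fun ρ => (_root_.isolateStep G k).Adj (ρ 0) (ρ 1) :=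
  (defines_adj 0 1).and ((defines_firstIsolatable (by norm_num)).not.and
    (defines_firstIsolatable (by norm_num)).not)

def forcedStep : Term :=
  .and (adj 0 1) (.and (.not (firstForced 0 1)) (.not (firstForced 1 0)))

theorem defines_forcedStep :
    Defines G k forcedStep fun ρ => (_root_.forcedStep G k).Adj (ρ 0) (ρ 1) :=
  (defines_adj 0 1).and ((defines_firstForced (by norm_num) (by norm_num)).not.and
    (defines_firstForced (by norm_num) (by norm_num)).not)

theorem Defines.ite {t u v : Term} {P : (ℕ → Fin n) → Prop} {F F' : (ℕ → Fin n) → ℕ}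
    (h : Defines G k t P) (hu : Computes G k u F) (hv : Computes G k v F') :
    Computes G k (.ite t u v) fun ρ => if P ρ then F ρ else F' ρ := fun ρ s hs => by
  simp only [eval, h ρ s hs, hu ρ s hs, hv ρ s hs]

theorem Computes.sub {t u : Term} {F F' : (ℕ → Fin n) → ℕ} (h : Computes G k t F)
    (h' : Computes G k u F') : Computes G k (t.sub u) fun ρ => F ρ - F' ρ := fun ρ s hs => by
  simp only [eval, h ρ s hs, h' ρ s hs]

def forcedPar : Term := .ite (.ex 0 (.ex 1 (forcedEdge 0 1))) (.sub .par (.const 1)) .par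

theorem computes_forcedPar : Computes G k forcedPar fun _ => _root_.forcedPar G k :=
  ((((defines_forcedEdge (by norm_num) (by norm_num)).ex 1).ex 0).ite
    (computes_par.sub (computes_const 1)) computes_par).congr fun ρ => by
      simp [_root_.forcedPar]

def rank (x : ℕ) : Term := .count 11 (.and (.lt (.var 11) (.var x)) (hasNeighbor 11))

theorem computes_rank {x : ℕ} (h : x ≠ 11) :
    Computes G k (rank x) fun ρ => _root_.rank G (ρ x) :=
  ((((computes_var 11).lt (computes_var x)).and (defines_hasNeighbor (by norm_num))).count 11).congr
    fun ρ => by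
      simp only [_root_.rank, Function.update_self, Function.update_of_ne h]

def supportCard : Term := .count 11 (hasNeighbor 11)

theorem computes_supportCard : Computes G k supportCard fun _ => _root_.supportCard G :=
  ((defines_hasNeighbor (by norm_num)).count 11).congr fun ρ => by
    simp only [_root_.supportCard, Function.update_self]

/-- Multiplication by the minimum of `size` and `par`. -/
def mulPar (x : ℕ) (t : Term) : Term := .sum x (.ite (.lt (.var x) .par) t (.const 0))

theorem Computes.mulPar {t : Term} {c : ℕ} (x : ℕ) (h : Computes G k t fun _ => c) :
    Computes G k (mulPar x t) fun _ => min n k * c := fun ρ s hs => by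
  have h1 : ∀ i : Fin n, (Term.ite (.lt (.var x) .par) t (.const 0)).eval 0
      (s.setReg (2 * x + 4) i) = if (i : ℕ) < k then c else 0 := fun i => by
    have := (((computes_var x).lt computes_par).ite h (computes_const 0)) _ _ (hs.set x i)
    simpa using this
  simp only [Term.mulPar, eval, hs.size]
  rw [Finset.sum_range]
  refine (Finset.sum_congr rfl fun i _ => h1 i).trans ?_
  rw [← Finset.sum_range (fun i => if i < k then c else 0), ← Finset.sum_filter,
    Finset.sum_const, smul_eq_mul]
  congr 1
  rw [← Finset.card_range (min n k)]
  congr 1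
  ext i
  simp

/-- The reduced graph is too large for a yes-instance. -/
def tooLarge : Term :=
  .lt (.add (.smul 44 (mulPar 12 (mulPar 13 (mulPar 14 (.const 1))))) (.const 4)) supportCard

/-- Sums run only up to `n`, so the cube of `k` is available only as that of `min n k`. The summand
`4` ensures that a graph declared too large has room for the paw in its matrix. -/
theorem defines_tooLarge :
    Defines G k tooLarge fun _ => 44 * min n k ^ 3 + 4 < _root_.supportCard G :=
  (((((((computes_const 1).mulPar 14).mulPar 13).mulPar 12).smul 44).add (computes_const 4)).lt
    computes_supportCard).congr fun ρ => by
      rw [show min n k * (min n k * (min n k * 1)) = min n k ^ 3 by ring]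

def compact : Term :=
  .ex 2 (.ex 3 (.and (adj 2 3) (.and (.eq (rank 2) (.var 0)) (.eq (rank 3) (.var 1)))))

theorem defines_compact : Defines G k compact fun ρ =>
    ∃ u v, G.Adj u v ∧ _root_.rank G u = ρ 0 ∧ _root_.rank G v = ρ 1 :=
  (((((defines_adj 2 3).and (((computes_rank (by norm_num)).eq (computes_var 0)).and
    ((computes_rank (by norm_num)).eq (computes_var 1))))).ex 3).ex 2).congr fun ρ => by simp

def isEntry (a b : ℕ) : Term := .and (.eq (.var 0) (.const a)) (.eq (.var 1) (.const b))

theorem defines_isEntry (a b : ℕ) :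
    Defines G k (isEntry a b) fun ρ => (ρ 0 : ℕ) = a ∧ (ρ 1 : ℕ) = b :=
  ((computes_var 0).eq (computes_const a)).and ((computes_var 1).eq (computes_const b))

def paw : Term :=
  .or (isEntry 0 1) (.or (isEntry 1 0) (.or (isEntry 0 2) (.or (isEntry 2 0) (.or (isEntry 1 2)
    (.or (isEntry 2 1) (.or (isEntry 2 3) (isEntry 3 2)))))))

theorem defines_paw : Defines G k paw fun ρ =>
    ((ρ 0 : ℕ), (ρ 1 : ℕ)) ∈ [(0, 1), (1, 0), (0, 2), (2, 0), (1, 2), (2, 1), (2, 3), (3, 2)] :=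
  ((defines_isEntry 0 1).or ((defines_isEntry 1 0).or ((defines_isEntry 0 2).or
    ((defines_isEntry 2 0).or ((defines_isEntry 1 2).or ((defines_isEntry 2 1).or
      ((defines_isEntry 2 3).or (defines_isEntry 3 2)))))))).congr fun ρ => by simp

/-- The adjacency matrix of the output. -/
def output : Term := .ite tooLarge (.ite paw (.const 1) (.const 0))
  (.ite compact (.const 1) (.const 0))

end Term

/-- Copy array `1` to array `0`. -/
def copy : Prog := fill 1 0 (adj 0 1)

/-- Replace the graph by the graph with the adjacency relation `t`, and the parameter by `u`. -/
def update (t u : Term) : Prog :=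
  .seq (fill 0 1 (.ite t (.const 1) (.const 0)))
    (.seq (.seq (u.compile 0 0) (.assign 2 (.reg 3))) copy)

/-- A bound for the running time of `update`. -/
noncomputable def updateCost (t u : Term) : Polynomial ℕ :=
  fillCost (.ite t (.const 1) (.const 0)) + (u.cost + 2 + fillCost (adj 0 1))

theorem Filled.exists_var {a dst : ℕ} {t : Term} (h : Filled a dst t s s')
    (hs : Represents G k ρ s) : ∃ ρ' : ℕ → Fin n, ∀ x, s'.reg (2 * x + 4) = ρ' x := by
  have hn : 0 < n := (Nat.zero_le _).trans_lt (ρ 0).2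
  have : ∀ x, ∃ i : Fin n, s'.reg (2 * x + 4) = i := by
    intro x
    by_cases h0 : x = 0
    · exact ⟨⟨0, hn⟩, by rw [h0]; exact h.reg_four⟩
    by_cases h1 : x = 1
    · subst h1
      rcases h.reg_six with h6 | h6
      · exact ⟨⟨0, hn⟩, h6⟩
      · exact ⟨ρ 1, h6.trans (hs.var 1)⟩
    · exact ⟨ρ x, by rw [h.reg _ (by omega) (by omega) (by omega), hs.var]⟩
  exact ⟨fun x => (this x).choose, fun x => (this x).choose_spec⟩

theorem Filled.represents {t : Term} (h : Filled 0 1 t s s') (hs : Represents G k ρ s) :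
    ∃ ρ' : ℕ → Fin n, Represents G k ρ' s' := by
  obtain ⟨ρ', hρ'⟩ := h.exists_var hs
  refine ⟨ρ', ?_, ?_, hρ', ?_⟩
  · rw [h.reg 0 rfl (by norm_num) (by norm_num), hs.size]
  · rw [h.reg 2 rfl (by norm_num) (by norm_num), hs.par]
  · rw [h.arr_of_ne 0 (by norm_num)]; exact hs.arr

theorem Filled.arr_one {t : Term} {F : (ℕ → Fin n) → ℕ} (h : Filled 0 1 t s s')
    (hs : Represents G k ρ s) (ht : Computes G k t F) (i j : Fin n) :
    s'.arr 1 i j = F (Function.update (Function.update ρ 0 i) 1 j) := by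
  rw [h.arr i (hs.size ▸ i.2) j (hs.size ▸ j.2)]
  exact ht _ _ ((hs.set 0 i).set 1 j)

/-- The new matrix is built in array `1`, and the new parameter is computed while array `0` still
holds the old graph; only then is the matrix copied back. -/
theorem runs_update {t u : Term} (hs : Represents G k ρ s)
    (ht : Defines G k t fun ρ => G'.Adj (ρ 0) (ρ 1)) (hu : Computes G k u fun _ => k') :
    Runs (update t u) s ((updateCost t u).eval n) fun s' =>
      (∃ ρ' : ℕ → Fin n, Represents G' k' ρ' s') ∧
        ∀ r, r % 2 = 0 → r ≠ 2 → r ≠ 4 → r ≠ 6 → s'.reg r = s.reg r := by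
  have hfill := runs_fill (a := 0) (dst := 1) (by norm_num) (.ite t (.const 1) (.const 0)) s
  rw [hs.size] at hfill
  refine ((hfill.seq (c' := u.cost.eval n + 2 + (fillCost (adj 0 1)).eval n) fun s₁ h₁ => ?_).mono
    ?_ fun _ h => h)
  · obtain ⟨ρ₁, hs₁⟩ := h₁.represents hs
    have hcompile := u.runs_compile 0 0 s₁
    rw [hs₁.size] at hcompile
    refine (hcompile.seq (c' := 2) (R := fun s₂ => s₂.reg 2 = k' ∧
      (∀ r, r % 2 = 0 → r ≠ 2 → s₂.reg r = s₁.reg r) ∧ s₂.arr = s₁.arr) ?_).seq ?_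
    · rintro s₂ ⟨h1, h2, h3⟩
      refine (Runs.assign ?_).mono (by simp [Expr.cost]) fun _ h => h
      refine ⟨?_, fun r hr hr2 => ?_, h2⟩
      · rw [State.setReg_reg, if_pos rfl]
        exact h1.trans (hu _ _ hs₁)
      · rw [State.setReg_reg, if_neg hr2, h3 r (.inl hr)]
    · rintro s₂ ⟨h1, h2, h3⟩
      have hn₂ : s₂.reg 0 = n := by rw [h2 0 rfl (by norm_num), hs₁.size]
      have hcopy := runs_fill (a := 1) (dst := 0) (by norm_num) (adj 0 1) s₂
      rw [hn₂] at hcopy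
      refine hcopy.mono le_rfl fun s₃ h₃ => ⟨?_, fun r hr hr2 hr4 hr6 => ?_⟩
      · have hs₂ : Represents G k' ρ₁ s₂ := by
          refine ⟨hn₂, h1, fun x => ?_, fun i j => ?_⟩
          · rw [h2 _ (by omega) (by omega), hs₁.var]
          · rw [h3, hs₁.arr]
        obtain ⟨ρ₃, hρ₃⟩ := h₃.exists_var hs₂
        refine ⟨ρ₃, ?_, ?_, hρ₃, fun i j => ?_⟩
        · rw [h₃.reg 0 rfl (by norm_num) (by norm_num), hn₂]
        · rw [h₃.reg 2 rfl (by norm_num) (by norm_num), h1]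
        · rw [h₃.arr i (hn₂ ▸ i.2) j (hn₂ ▸ j.2)]
          have h4 : (adj 0 1).eval 1 ((s₂.setReg 4 i).setReg 6 j) = s₂.arr 1 i j := by
            simp [adj, eval]
          rw [h4, h3, h₁.arr_one hs (ht.ite (computes_const 1) (computes_const 0))]
          simp
      · rw [h₃.reg r hr hr4 hr6, h2 r hr hr2, h₁.reg r hr hr4 hr6]
  · simp [updateCost, fillCost]

/-- One step of the reduction. -/
def step : Prog := .seq (update isolateStep .par) (update forcedStep forcedPar)

/-- A bound for the running time of `step`. -/
noncomputable def stepCost : Polynomial ℕ :=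
  updateCost isolateStep .par + updateCost forcedStep forcedPar

theorem runs_step (hs : Represents G k ρ s) : Runs step s (stepCost.eval n) fun s' =>
    (∃ ρ' : ℕ → Fin n, Represents (reductionStep (G, k)).1 (reductionStep (G, k)).2 ρ' s') ∧
      ∀ r, r % 2 = 0 → r ≠ 2 → r ≠ 4 → r ≠ 6 → s'.reg r = s.reg r := by
  have h₁ := runs_update hs defines_isolateStep computes_par
  refine (h₁.seq (c' := (updateCost forcedStep forcedPar).eval n) ?_).mono
    (by rw [stepCost, Polynomial.eval_add]) fun _ h => h
  rintro s₁ ⟨⟨ρ₁, hs₁⟩, h₁⟩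
  refine (runs_update hs₁ defines_forcedStep computes_forcedPar).mono le_rfl ?_
  rintro s₂ ⟨h2, h3⟩
  refine ⟨h2, fun r hr hr2 hr4 hr6 => ?_⟩
  rw [h3 r hr hr2 hr4 hr6, h₁ r hr hr2 hr4 hr6]

/-- Apply the reduction rules exhaustively. -/
def reduce : Prog := forLoop 44 (forLoop 46 step)

/-- A bound for the running time of `reduce`. -/
noncomputable def reduceCost : Polynomial ℕ :=
  Polynomial.X * (Polynomial.X * (stepCost + 8) + 8 + 8) + 8

theorem Represents.set_reg (hs : Represents G k ρ s) {x i : ℕ} (hi : i < n) :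
    ∃ ρ' : ℕ → Fin n, Represents G k ρ' (s.setReg (2 * x + 4) i) :=
  ⟨_, hs.set x ⟨i, hi⟩⟩

theorem runs_reduce (hs : Represents G k ρ s) : Runs reduce s (reduceCost.eval n) fun s' =>
    ∃ ρ' : ℕ → Fin n, Represents (reductionStep^[n * n] (G, k)).1
      (reductionStep^[n * n] (G, k)).2 ρ' s' := by
  have hn : 0 < n := (Nat.zero_le _).trans_lt (ρ 0).2
  -- the registers `44` and `46` are counters that may reach `n`
  let R : ℕ → State → Prop := fun m s' => ∃ ρ' : ℕ → Fin n,
    Represents (reductionStep^[m] (G, k)).1 (reductionStep^[m] (G, k)).2 ρ'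
      ((s'.setReg 44 0).setReg 46 0)
  have hR : ∀ {m s' s''}, s''.arr = s'.arr → (∀ r, r ≠ 44 → r ≠ 46 → s''.reg r = s'.reg r) →
      R m s' → R m s'' := by
    rintro m s' s'' h1 h2 ⟨ρ', h⟩
    refine ⟨ρ', ?_⟩
    convert h using 1
    ext r
    · simp only [State.setReg_reg]
      by_cases h3 : r = 46
      · simp [h3]
      by_cases h4 : r = 44
      · simp [h4]
      simp [h3, h4, h2 r h4 h3]
    · simp [h1]
  have hRset : ∀ {m s' x v}, (x = 44 ∨ x = 46) → R m s' → R m (s'.setReg x v) := by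
    intro m s' x v hx
    refine hR rfl fun r h1 h2 => ?_
    rw [State.setReg_reg, if_neg (by omega)]
  have hRn : ∀ {m s'}, R m s' → s'.reg 0 = n := by
    rintro m s' ⟨ρ', h⟩
    simpa using h.size
  -- Registers `44` and `46` are the variables `20` and `21`; below `n` their contents are
  -- legitimate vertices.
  have hR' : ∀ {m s'}, R m s' → s'.reg 44 < n → s'.reg 46 < n → ∃ ρ' : ℕ → Fin n,
      Represents (reductionStep^[m] (G, k)).1 (reductionStep^[m] (G, k)).2 ρ' s' := by
    rintro m s' ⟨ρ', h⟩ h44 h46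
    refine ⟨Function.update (Function.update ρ' 20 ⟨_, h44⟩) 21 ⟨_, h46⟩, ?_⟩
    convert (h.set 20 ⟨_, h44⟩).set 21 ⟨_, h46⟩ using 1
    ext r
    · simp only [State.setReg_reg]
      split_ifs with h3 h4 <;> simp_all
    · simp
  have hfor : Runs reduce s (n * (n * (stepCost.eval n + 8) + 8 + 8) + 8) fun s' =>
      ∃ s'', (s''.reg 44 = n ∧ s''.reg 46 < n ∧ R (n * n) s'') ∧ s' = s''.setReg 44 0 := by
    refine Runs.forLoop (fun i s' => s'.reg 44 = i ∧ s'.reg 46 < n ∧ R (n * i) s') ?_ ?_ ?_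
    · refine ⟨by simp, ?_, hRset (.inl rfl) ?_⟩
      · simpa using (hs.var 21).trans_lt (ρ 21).2
      obtain ⟨ρ₁, h1⟩ := hs.set_reg (x := 20) hn
      obtain ⟨ρ₂, h2⟩ := h1.set_reg (x := 21) hn
      exact ⟨ρ₂, by simpa using h2⟩
    · rintro i s' ⟨h1, -, h2⟩
      exact ⟨hRn h2, h1⟩
    · rintro i s₁ hi ⟨h1, -, h2⟩
      refine (Runs.forLoop (n := n) (c := stepCost.eval n)
        (fun j s' => s'.reg 46 = j ∧ s'.reg 44 = i ∧ R (n * i + j) s')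
        ?_ ?_ ?_).mono le_rfl ?_
      · exact ⟨by simp, by simp [h1], hRset (.inr rfl) h2⟩
      · rintro j s' ⟨h3, -, h4⟩
        exact ⟨hRn h4, h3⟩
      · rintro j s₂ hj ⟨h3, h4, h5⟩
        obtain ⟨ρ₂, hs₂⟩ := hR' h5 (by omega) (by omega)
        refine (runs_step hs₂).mono le_rfl fun s₃ ⟨⟨ρ₃, hs₃⟩, h6⟩ => ?_
        have e46 := h6 46 rfl (by norm_num) (by norm_num) (by norm_num)
        have e44 := h6 44 rfl (by norm_num) (by norm_num) (by norm_num)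
        refine ⟨by simp [e46, h3], by simp [e44, h4], hRset (.inr rfl) ?_⟩
        obtain ⟨ρ₄, hs₄⟩ := hs₃.set_reg (x := 20) hn
        obtain ⟨ρ₅, hs₅⟩ := hs₄.set_reg (x := 21) hn
        refine ⟨ρ₅, ?_⟩
        rw [← add_assoc, Function.iterate_succ_apply']
        exact hs₅
      · rintro _ ⟨s₂, ⟨-, h4, h5⟩, rfl⟩
        refine ⟨by simp [h4], by simpa using hn, hRset (.inl rfl) (hRset (.inr rfl) ?_)⟩
        rwa [mul_add, mul_one]
  refine hfor.mono (by simp [reduceCost]) ?_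
  rintro _ ⟨s₁, ⟨-, h1, h2⟩, rfl⟩
  exact hR' (hRset (.inl rfl) h2) (by simpa using hn) (by simpa using h1)

/-- Output the reduced graph without its isolated vertices, or a paw if it is too large. -/
def finish : Prog :=
  .seq (fill 0 1 output)
    (.seq ((Term.ite tooLarge (.const 4) supportCard).compile 0 0)
      (.seq ((Term.ite tooLarge (.const 0) .par).compile 0 1)
        (.seq (.assign 64 (.reg 3)) (.seq (.assign 66 (.reg 5))
          (.seq copy (.seq (.assign 0 (.reg 64)) (.assign 1 (.reg 66))))))))

/-- A bound for the running time of `finish`. -/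
noncomputable def finishCost : Polynomial ℕ :=
  fillCost output + ((Term.ite tooLarge (.const 4) supportCard).cost +
    ((Term.ite tooLarge (.const 0) .par).cost + (fillCost (adj 0 1) + 8)))

/-- The output of `finish`. -/
noncomputable def kernel (G : SimpleGraph (Fin n)) (k : ℕ) : GraphInstance :=
  if 44 * min n k ^ 3 + 4 < _root_.supportCard G then ⟨4, _root_.paw, 0⟩
  else ⟨_root_.supportCard G, compactGraph G, k⟩

theorem supportCard_le (G : SimpleGraph (Fin n)) : _root_.supportCard G ≤ n :=
  (Finset.card_filter_le _ _).trans (by simp)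

theorem isOutput_kernel {t : State} (h0 : t.reg 0 = (kernel G k).n)
    (h1 : t.reg 1 = (kernel G k).k)
    (harr : ∀ i j : Fin n, t.arr 0 i j =
      if 44 * min n k ^ 3 + 4 < _root_.supportCard G then
        if ((i : ℕ), (j : ℕ)) ∈
          [(0, 1), (1, 0), (0, 2), (2, 0), (1, 2), (2, 1), (2, 3), (3, 2)] then 1 else 0
      else if ∃ u v, G.Adj u v ∧ _root_.rank G u = i ∧ _root_.rank G v = j then 1 else 0) :
    (kernel G k).IsOutput t := by
  refine ⟨h0, h1, ?_⟩
  have hle := supportCard_le G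
  by_cases hbig : 44 * min n k ^ 3 + 4 < _root_.supportCard G
  · rw [kernel, if_pos hbig]
    intro i j
    have h4 : 4 ≤ n := by omega
    have := harr ⟨i, i.2.trans_le h4⟩ ⟨j, j.2.trans_le h4⟩
    rw [if_pos hbig] at this
    rw [this]
    refine if_congr ?_ rfl rfl
    rw [paw_adj]
    fin_cases i <;> fin_cases j <;> simp
  · rw [kernel, if_neg hbig]
    intro i j
    have := harr ⟨i, i.2.trans_le hle⟩ ⟨j, j.2.trans_le hle⟩
    rw [if_neg hbig] at this
    rw [this]
    exact if_congr Iff.rfl rfl rfl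

/-- Copying still needs the old size in register `0` and uses odd registers as scratch memory. The
new size and parameter therefore wait in the even registers `64` and `66`. -/
theorem runs_finish (hs : Represents G k ρ s) :
    Runs finish s (finishCost.eval n) (kernel G k).IsOutput := by
  have hfill := runs_fill (a := 0) (dst := 1) (by norm_num) output s
  rw [hs.size] at hfill
  have hcost : finishCost.eval n = (fillCost output).eval n +
      ((Term.ite tooLarge (.const 4) supportCard).cost.eval n +
      ((Term.ite tooLarge (.const 0) .par).cost.eval n + (2 + (2 + ((fillCost (adj 0 1)).eval n +
        (2 + 2)))))) := by
    unfold finishCost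
    generalize fillCost output = p, fillCost (adj 0 1) = q,
      (Term.ite tooLarge (.const 4) supportCard).cost = r,
      (Term.ite tooLarge (.const 0) .par).cost = u
    simp
    omega
  rw [hcost]
  refine hfill.seq fun s₁ h₁ => ?_
  obtain ⟨ρ₁, hs₁⟩ := h₁.represents hs
  have hN := (Term.ite tooLarge (.const 4) supportCard).runs_compile 0 0 s₁
  rw [hs₁.size, (defines_tooLarge.ite (computes_const 4) computes_supportCard) _ _ hs₁] at hN
  refine hN.seq ?_
  rintro s₂ ⟨h2, h3, h4⟩
  have hs₂ : Represents G k ρ₁ s₂ := by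
    refine ⟨?_, ?_, fun x => ?_, fun i j => ?_⟩
    · rw [h4 _ (.inl rfl), hs₁.size]
    · rw [h4 _ (.inl rfl), hs₁.par]
    · rw [h4 _ (.inl (by omega)), hs₁.var]
    · rw [h3, hs₁.arr]
  have hk := (Term.ite tooLarge (.const 0) .par).runs_compile 0 1 s₂
  rw [hs₂.size, (defines_tooLarge.ite (computes_const 0) computes_par) _ _ hs₂] at hk
  refine hk.seq ?_
  rintro s₃ ⟨h5, h6, h7⟩
  refine Runs.seq (c := 2) (Runs.assign (Q := fun s' => s' = s₃.setReg 64 (s₃.reg 3)) rfl) ?_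
  rintro _ rfl
  refine Runs.seq (c := 2) (Runs.assign
    (Q := fun s' => s' = (s₃.setReg 64 (s₃.reg 3)).setReg 66 (s₃.reg 5)) ?_) ?_
  · simp [Expr.eval]
  rintro _ rfl
  set s₄ := (s₃.setReg 64 (s₃.reg 3)).setReg 66 (s₃.reg 5) with hs₄
  have hn₄ : s₄.reg 0 = n := by
    simp [hs₄, h7 0 (.inl rfl), hs₂.size]
  have hcopy := runs_fill (a := 1) (dst := 0) (by norm_num) (adj 0 1) s₄
  rw [hn₄] at hcopy
  refine hcopy.seq fun s₅ h₅ => ?_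
  refine Runs.seq (c := 2) (Runs.assign (Q := fun s' => s' = s₅.setReg 0 (s₅.reg 64)) rfl) ?_
  rintro _ rfl
  refine Runs.assign (isOutput_kernel ?_ ?_ fun i j => ?_)
  · simp only [State.setReg_reg, if_true]
    rw [if_neg (by norm_num), h₅.reg 64 rfl (by norm_num) (by norm_num), hs₄]
    simp only [State.setReg_reg, if_true]
    rw [if_neg (by norm_num), h7 3 (.inr (by norm_num)), h2, kernel]
    split_ifs <;> rfl
  · simp only [State.setReg_reg, if_true, Expr.eval]
    rw [if_neg (by norm_num), h₅.reg 66 rfl (by norm_num) (by norm_num), hs₄]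
    simp only [State.setReg_reg, if_true]
    rw [h5, kernel]
    split_ifs <;> rfl
  · simp only [State.setReg_arr]
    rw [h₅.arr i (hn₄ ▸ i.2) j (hn₄ ▸ j.2)]
    have h8 : (adj 0 1).eval 1 ((s₄.setReg 4 i).setReg 6 j) = s₁.arr 1 i j := by
      simp [adj, eval, hs₄, h6, h3]
    rw [h8, h₁.arr_one hs (defines_tooLarge.ite
      (defines_paw.ite (computes_const 1) (computes_const 0))
      (defines_compact.ite (computes_const 1) (computes_const 0)))]
    simp

/-- The kernelization program. -/
def kernelization : Prog :=
  .ite (.reg 0) (.seq (.assign 2 (.reg 1)) (.seq reduce finish)) .skip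

/-- A bound for the running time of `kernelization`. -/
noncomputable def kernelizationCost : Polynomial ℕ := 2 + (2 + (reduceCost + finishCost))

theorem represents_initialState (I : GraphInstance) (hI : 0 < I.n) :
    Represents I.graph I.k (fun _ => ⟨0, hI⟩) (I.initialState.setReg 2 I.k) := by
  refine ⟨by simp [GraphInstance.initialState], by simp, fun x => ?_, fun i j => ?_⟩
  · rw [State.setReg_reg, if_neg (by omega)]
    simp only [GraphInstance.initialState]
    rw [if_neg (by omega), if_neg (by omega)]
  · simp [GraphInstance.initialState]

/-- Variables must denote vertices, so the graph without vertices is treated separately and output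
unchanged. -/
theorem runs_kernelization (I : GraphInstance) :
    Runs kernelization I.initialState (kernelizationCost.eval I.n) fun s =>
      (if 0 < I.n then kernel (reductionStep^[I.n * I.n] (I.graph, I.k)).1
        (reductionStep^[I.n * I.n] (I.graph, I.k)).2 else I).IsOutput s := by
  have hreg : (Expr.reg 0).eval I.initialState = I.n := by
    simp [Expr.eval, GraphInstance.initialState]
  refine (Runs.ite (c := 2 + (reduceCost.eval I.n + finishCost.eval I.n)) (fun h => ?_)
    fun h => ?_).mono (le_of_eq ?_) fun _ h => h
  · rw [hreg] at h
    have hI := Nat.pos_of_ne_zero h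
    rw [if_pos hI]
    refine Runs.seq (c := 2) (Runs.assign (Q := fun s => s = I.initialState.setReg 2 I.k) ?_) ?_
    · simp [Expr.eval, GraphInstance.initialState]
    · rintro _ rfl
      exact (runs_reduce (represents_initialState I hI)).seq fun s ⟨ρ, hs⟩ => runs_finish hs
  · rw [hreg] at h
    rw [if_neg (by omega)]
    refine ⟨_, _, .skip _, by omega, hreg, ?_, fun i => ?_⟩
    · simp [GraphInstance.initialState]
    · exact absurd i.2 (by omega)
  · unfold kernelizationCost
    generalize reduceCost = p, finishCost = q
    simp [Expr.cost]

end RAM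

/-! ### Correctness and size of the kernel -/

theorem Polynomial.eval_mono_nat (P : Polynomial ℕ) {a b : ℕ} (h : a ≤ b) :
    P.eval a ≤ P.eval b := by
  rw [Polynomial.eval_eq_sum, Polynomial.eval_eq_sum]
  exact Finset.sum_le_sum fun i _ => Nat.mul_le_mul_left _ (Nat.pow_le_pow_left h i)

theorem mem_pawFreeEdgeDeletion_iff (I : GraphInstance) :
    I ∈ PawFreeEdgeDeletion ↔ PawDeletable I.graph I.k :=
  exists_solution_iff I.graph I.k

/-- Replacing `k` by `min n k` in the size test is harmless: for `n ≤ k` the graph has at most `n ≤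
n ^ 3` nonisolated vertices and never counts as too large. -/
theorem kernel_spec {n : ℕ} {p : SimpleGraph (Fin n) × ℕ} (hp : Reduced p) :
    (PawDeletable (RAM.kernel p.1 p.2).graph (RAM.kernel p.1 p.2).k ↔ PawDeletable p.1 p.2) ∧
      (RAM.kernel p.1 p.2).n + (RAM.kernel p.1 p.2).k ≤ 44 * p.2 ^ 3 + p.2 + 4 := by
  by_cases hbig : 44 * min n p.2 ^ 3 + 4 < supportCard p.1
  · rw [RAM.kernel, if_pos hbig]
    refine ⟨iff_of_false not_pawDeletable_paw fun hyes => ?_, by simp⟩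
    have h1 := supportCard_le_of_reduced hp hyes
    rcases le_total n p.2 with h | h
    · rw [min_eq_left h] at hbig
      have h2 := RAM.supportCard_le p.1
      have h3 : n ≤ n ^ 3 := Nat.le_self_pow (by norm_num) n
      omega
    · rw [min_eq_right h] at hbig
      omega
  · rw [RAM.kernel, if_neg hbig]
    refine ⟨pawDeletable_compactGraph _ _, ?_⟩
    have : min n p.2 ^ 3 ≤ p.2 ^ 3 := Nat.pow_le_pow_left (min_le_right _ _) 3
    change supportCard p.1 + p.2 ≤ _
    omega

theorem computable_kernelSize : Computable fun k : ℕ => 44 * k ^ 3 + k + 4 := by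
  have hmul : Primrec₂ fun a b : ℕ => a * b := Primrec.nat_mul
  have hadd : Primrec₂ fun a b : ℕ => a + b := Primrec.nat_add
  have h3 : Primrec fun k : ℕ => k * (k * k) :=
    hmul.comp Primrec.id (hmul.comp Primrec.id Primrec.id)
  have h : Primrec fun k : ℕ => 44 * (k * (k * k)) + k + 4 :=
    hadd.comp (hadd.comp (hmul.comp (Primrec.const 44) h3) Primrec.id) (Primrec.const 4)
  exact (h.of_eq fun k => by ring).to_comp

theorem isBigO_kernelSize :
    (fun k : ℕ => ((44 * k ^ 3 + k + 4 : ℕ) : ℝ)) =O[Filter.atTop] fun k : ℕ => (k : ℝ) ^ 3 := by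
  -- `49 = 44 + 1 + 4`, as `1` and `k` are at most `k ^ 3` for `k ≥ 1`.
  refine Asymptotics.IsBigO.of_bound 49 ?_
  filter_upwards [Filter.eventually_ge_atTop 1] with k hk
  rw [Real.norm_of_nonneg (by positivity), Real.norm_of_nonneg (by positivity)]
  have h1 : k ≤ k ^ 3 := Nat.le_self_pow (by norm_num) k
  have h2 : 44 * k ^ 3 + k + 4 ≤ 49 * k ^ 3 := by omega
  exact_mod_cast h2

theorem mainTheorem2 :
    ∃ f : ℕ → ℕ,
      (fun k : ℕ => (f k : ℝ)) =O[Filter.atTop] (fun k : ℕ => (k : ℝ) ^ 3) ∧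
      HasVertexKernel PawFreeEdgeDeletion f := by
  refine ⟨fun k => 44 * k ^ 3 + k + 4, isBigO_kernelSize, computable_kernelSize,
    RAM.kernelization, RAM.kernelizationCost, fun I => ?_⟩
  obtain ⟨s, t, h1, h2, h3⟩ := RAM.runs_kernelization I
  refine ⟨_, s, t, h1, h2.trans (Polynomial.eval_mono_nat _ (Nat.le_add_right _ _)), h3, ?_⟩
  rw [mem_pawFreeEdgeDeletion_iff, mem_pawFreeEdgeDeletion_iff]
  by_cases hI : 0 < I.n
  · rw [if_pos hI]
    obtain ⟨h4, h5⟩ := kernel_spec (reduced_iterate (I.graph, I.k))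
    obtain ⟨h6, h7⟩ := pawDeletable_iterate (I.graph, I.k) (I.n * I.n)
    refine ⟨(h4.trans h6).symm, h5.trans ?_⟩
    have := Nat.pow_le_pow_left h7 3
    dsimp only at this h7 ⊢
    omega
  · rw [if_neg hI]
    exact ⟨Iff.rfl, by dsimp only; omega⟩
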